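/- Let $n\ge 2$ and let Alice and Bob each control $n$ fermion modes. Let $\mathcal H=F_-(\mathbb C^n)$ be the antisymmetric Fock space with creation and annihilation operators $c_j^\dagger,c_j$, number operator $N$ and parity $\theta=(-1)^{N}$, and let $\mathcal H_+,\mathcal H_-$ be its subspaces of even and odd particle number. On $\mathcal H\otimes\mathcal H$ put $c_{a_j}=c_j\otimes 1$ (Alice's modes) and $c_{b_j}=\theta\otimes c_j$ (Bob's modes). Let $K_A=K_B=\mathbb C^n\oplus\mathbb C^n$ with complex conjugations $\Gamma_A=\Gamma_B:(f^+,f^-)\mapsto(\overline{f^-},\overline{f^+})$, let $\Gamma=\Gamma_A\oplus\Gamma_B$ on $K_A\oplus K_B$, and let $B(f)=\sum_j f_j^+c_j+f_j^-c_j^\dagger$, where $f\in K_A\oplus K_B$ and the sum is over all $2n$ modes. A state with density operator $\varrho$ on $\mathcal H\otimes\mathcal H$ is called quasifree with covariance $S$, where $S$ is a linear operator on $K_A\oplus K_B$, if $\operatorname{tr}(\varrho B(f)B(g))=\langle\Gamma f,Sg\rangle$ for all $f,g$ and all correlation functions are given by Wick's theorem: $\operatorname{tr}(\varrho B(f_1)\cdots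 B(f_k))$ is $0$ for odd $k$, and for even $k$ it is the sum over all pairings of $\{1,\dots,k\}$ of the sign of the pairing times the product of the two-point functions of its pairs. A state $\varrho$ is called maximally entangled if it is pure and, in the decomposition $\bigoplus_{a,b=\pm}p_{ab}\sigma_{ab}$ of its restriction to the operators that preserve both local parities, with states $\sigma_{ab}$ on $\mathcal H_a\otimes\mathcal H_b$, each $\sigma_{ab}$ with $p_{ab}\neq0$ is maximally entangled in the usual sense (pure with totally mixed reduced states). A local Bogolubov transformation is $V=V_A\oplus V_B$ with unitaries $V_A$ on $K_A$ and $V_B$ on $K_B$ that commute with $\Gamma_A$ and $\Gamma_B$, respectively; it maps a state $\varrho$ to $U_V^\dagger\varrho\,U_V$, where $U_V$ is a unitary on $\mathcal H\otimes\mathcal H$ with $U_V^\dagger B(f)U_V=B(Vf)$ for all $f$. Theorem. Up to local Bogolubov transformations, there exists a unique maximally entangled quasifree fermion state. Precisely: (1) There is exactly one quasifree state $\varrho_{\rm st}$ with covariance $$P_{\rm st}=\frac12\begin{pmatrix}1&i1\\-i1&1\end{pmatrix},$$ and it is maximally entangled. (2) Every local Bogolubov transformation $V$ maps $\varrho_{\rm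 st}$ to a maximally entangled quasifree state, whose covariance is $VP_{\rm st}V^\dagger$. (3) Every maximally entangled quasifree state is obtained from $\varrho_{\rm st}$ by some local Bogolubov transformation $V=V_A\oplus V_B$, and its covariance is $VP_{\rm st}V^\dagger$. -/

import Mathlib

open scoped Matrix Kronecker ComplexOrder

noncomputable section

namespace FermionPair

/-! ### One-particle spaces in the selfdual formalism

Alice and Bob each control `n` fermion modes. -/

/-- Coordinates of a local one-particle space `ℂⁿ ⊕ ℂⁿ`: `Sum.inl j` labels the component `f⁺ⱼ`
and `Sum.inr j` the component `f⁻ⱼ`. -/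
abbrev LocalIdx (n : ℕ) : Type := Fin n ⊕ Fin n

/-- Coordinates of the global one-particle space `K_A ⊕ K_B`. -/
abbrev GlobalIdx (n : ℕ) : Type := LocalIdx n ⊕ LocalIdx n

/-- The local complex conjugation `(f⁺, f⁻) ↦ (conj f⁻, conj f⁺)`. -/
def localConj {n : ℕ} (f : LocalIdx n → ℂ) : LocalIdx n → ℂ :=
  fun i => star (f i.swap)

/-- The global complex conjugation `Γ = Γ_A ⊕ Γ_B`. -/
def globalConj {n : ℕ} (f : GlobalIdx n → ℂ) : GlobalIdx n → ℂ :=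
  Sum.elim (localConj fun i => f (Sum.inl i)) (localConj fun i => f (Sum.inr i))

/-- A Bogolubov transformation of a local one-particle space: a unitary operator that commutes
with the local complex conjugation. -/
def IsLocalBogolubov {n : ℕ} (V : Matrix (LocalIdx n) (LocalIdx n) ℂ) : Prop :=
  V ∈ Matrix.unitaryGroup (LocalIdx n) ℂ ∧ ∀ f, localConj (V *ᵥ f) = V *ᵥ localConj f

/-- The block-diagonal operator `V_A ⊕ V_B` on `K_A ⊕ K_B`. -/
def blockDiag {n : ℕ} (VA VB : Matrix (LocalIdx n) (LocalIdx n) ℂ) :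
    Matrix (GlobalIdx n) (GlobalIdx n) ℂ :=
  Matrix.fromBlocks VA 0 0 VB

/-- The standard covariance `½ [[1, i1], [-i1, 1]]`. -/
def standardCov (n : ℕ) : Matrix (GlobalIdx n) (GlobalIdx n) ℂ :=
  (1 / 2 : ℂ) • Matrix.fromBlocks 1 (Complex.I • 1) (-(Complex.I • 1)) 1

/-! ### The fermion algebra on `ℋ ⊗ ℋ`, where `ℋ` is the antisymmetric Fock space over `ℂⁿ` -/

/-- The occupation number basis of the antisymmetric Fock space over `ℂⁿ`: the set
`I = {i₁ < ⋯ < i_k}` labels the normalized basis vector `e_I = e_{i₁} ∧ ⋯ ∧ e_{i_k}`. -/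
abbrev FockIdx (n : ℕ) : Type := Finset (Fin n)

/-- Operators on `ℋ`, in the occupation number basis. -/
abbrev FockOp (n : ℕ) : Type := Matrix (FockIdx n) (FockIdx n) ℂ

/-- Operators on `ℋ ⊗ ℋ`, in the product of the occupation number bases. This full matrix
algebra is the global fermion algebra. -/
abbrev PairOp (n : ℕ) : Type := Matrix (FockIdx n × FockIdx n) (FockIdx n × FockIdx n) ℂ

/-- The creation operator `c†ⱼ`: `c†ⱼ e_I = (-1)^{#{i ∈ I | i < j}} e_{I ∪ {j}}` if `j ∉ I`, and
`0` if `j ∈ I`. -/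
def creation {n : ℕ} (j : Fin n) : FockOp n :=
  Matrix.of fun J I =>
    if j ∉ I ∧ J = insert j I then (-1) ^ (I.filter (fun i => i < j)).card else 0

/-- The annihilation operator `cⱼ`, the adjoint of the creation operator. -/
def annihilation {n : ℕ} (j : Fin n) : FockOp n := (creation j)ᴴ

/-- The parity operator `θ = (-1)^N`. -/
def parityOp (n : ℕ) : FockOp n := Matrix.diagonal fun I => (-1) ^ I.card

/-- Alice's annihilation operators `cⱼ ⊗ 1`. -/
def annihilationA {n : ℕ} (j : Fin n) : PairOp n := annihilation j ⊗ₖ (1 : FockOp n)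

/-- Bob's annihilation operators `θ ⊗ cⱼ`. -/
def annihilationB {n : ℕ} (j : Fin n) : PairOp n := parityOp n ⊗ₖ annihilation j

/-- The selfdual Fermi field `B(f) = ∑ⱼ f⁺ⱼ cⱼ + f⁻ⱼ c†ⱼ`, the sum running over all modes of Alice
and Bob. -/
def field {n : ℕ} (f : GlobalIdx n → ℂ) : PairOp n :=
  ∑ j : Fin n,
    (f (Sum.inl (Sum.inl j)) • annihilationA j
      + f (Sum.inl (Sum.inr j)) • (annihilationA j)ᴴ
      + f (Sum.inr (Sum.inl j)) • annihilationB j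
      + f (Sum.inr (Sum.inr j)) • (annihilationB j)ᴴ)

/-! ### States -/

/-- Density operators. -/
def IsDensity {X : Type*} [Fintype X] (ρ : Matrix X X ℂ) : Prop :=
  ρ.PosSemidef ∧ ρ.trace = 1

/-- Pure states: projections onto a unit vector. -/
def IsPure {X : Type*} [Fintype X] (ρ : Matrix X X ℂ) : Prop :=
  ∃ ψ : X → ℂ, star ψ ⬝ᵥ ψ = 1 ∧ ρ = Matrix.vecMulVec ψ (star ψ)

/-- The two-point function `⟨Γ f, S g⟩` belonging to a covariance matrix `S`. -/
def twoPoint {n : ℕ} (S : Matrix (GlobalIdx n) (GlobalIdx n) ℂ) (f g : GlobalIdx n → ℂ) : ℂ :=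
  star (globalConj f) ⬝ᵥ (S *ᵥ g)

/-- The Wick sum (Pfaffian) `∑ sign · ∏ w(f_a, f_b)` over all pairings of `f₀, …, f_{k-1}`, where
`a < b` in each pair and the sign is that of the permutation listing the pairs; it is `0` for odd
`k`. It is computed by expansion along the partner of `f₀`. -/
def wickSum {E : Type*} (w : E → E → ℂ) : (k : ℕ) → (Fin k → E) → ℂ
  | 0, _ => 1
  | 1, _ => 0
  | k + 2, f =>
      ∑ j : Fin (k + 1),
        (-1) ^ (j : ℕ) * w (f 0) (f j.succ) * wickSum w k (fun i => f (j.succAbove i).succ)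

/-- `ρ` is the quasifree (Gaussian) state with covariance matrix `S`: its two-point function is
`tr(ρ B(f) B(g)) = ⟨Γ f, S g⟩`, and all correlation functions obey Wick's theorem. -/
structure IsQuasifreeWith {n : ℕ} (S : Matrix (GlobalIdx n) (GlobalIdx n) ℂ) (ρ : PairOp n) :
    Prop where
  isDensity : IsDensity ρ
  covariance : ∀ f g : GlobalIdx n → ℂ, (ρ * (field f * field g)).trace = twoPoint S f g
  wick : ∀ (k : ℕ) (f : Fin k → GlobalIdx n → ℂ),
    (ρ * (List.ofFn fun i => field (f i)).prod).trace = wickSum (twoPoint S) k f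

/-- Quasifree states. -/
def IsQuasifree {n : ℕ} (ρ : PairOp n) : Prop := ∃ S, IsQuasifreeWith S ρ

/-! ### Maximal entanglement -/

/-- Partial trace over the second tensor factor. -/
def traceRight {X Y : Type*} [Fintype Y] (σ : Matrix (X × Y) (X × Y) ℂ) : Matrix X X ℂ :=
  Matrix.of fun x x' => ∑ y, σ (x, y) (x', y)

/-- Partial trace over the first tensor factor. -/
def traceLeft {X Y : Type*} [Fintype X] (σ : Matrix (X × Y) (X × Y) ℂ) : Matrix Y Y ℂ :=
  Matrix.of fun y y' => ∑ x, σ (x, y) (x, y')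

/-- Maximal entanglement in the usual sense, for a state on `ℂ^X ⊗ ℂ^Y` with factors of equal
dimension: a pure state both of whose reduced states are totally mixed. -/
def IsMaxEntangledUsual {X Y : Type*} [Fintype X] [Fintype Y] [DecidableEq X] [DecidableEq Y]
    (σ : Matrix (X × Y) (X × Y) ℂ) : Prop :=
  IsPure σ ∧ traceRight σ = (Fintype.card X : ℂ)⁻¹ • 1 ∧ traceLeft σ = (Fintype.card Y : ℂ)⁻¹ • 1

/-- The basis of the sector of `ℋ` with particle number parity `a` (`0` is even, `1` is odd). -/
abbrev Sector (n : ℕ) (a : ZMod 2) : Type := {I : FockIdx n // (I.card : ZMod 2) = a}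

/-- The block of `ρ` that acts on `ℋ_a ⊗ ℋ_b`. The even-even algebra is the algebra of all
operators `X = ⨁ X_{ab}` that are block diagonal for these four subspaces, and
`tr(ρ X) = ∑ tr(ρ_{ab} X_{ab})` for such `X`, so the four blocks are the restriction of `ρ`. -/
def parityBlock {n : ℕ} (ρ : PairOp n) (a b : ZMod 2) :
    Matrix (Sector n a × Sector n b) (Sector n a × Sector n b) ℂ :=
  ρ.submatrix (fun x => (x.1.1, x.2.1)) (fun x => (x.1.1, x.2.1))

/-- A maximally entangled fermion state: it is pure on the global fermion algebra, and each state
`σ_{ab}` in the decomposition `∑ p_{ab} σ_{ab}` of its restriction to the even-even algebra (where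
`p_{ab}` is the trace of the block `p_{ab} σ_{ab}`) is maximally entangled in the usual sense. -/
def IsMaxEntangled {n : ℕ} (ρ : PairOp n) : Prop :=
  IsPure ρ ∧ ∀ a b : ZMod 2, (parityBlock ρ a b).trace ≠ 0 →
    IsMaxEntangledUsual ((parityBlock ρ a b).trace⁻¹ • parityBlock ρ a b)

/-! ### The action of Bogolubov transformations on states -/

/-- `ρ'` is obtained from `ρ` by the Bogolubov transformation `V`: for a unitary `U` that implements
the automorphism `B(f) ↦ B(V f) = U† B(f) U` one has `ρ' = U† ρ U`. -/
def IsBogolubovImage {n : ℕ} (V : Matrix (GlobalIdx n) (GlobalIdx n) ℂ) (ρ ρ' : PairOp n) : Prop :=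
  ∃ U ∈ Matrix.unitaryGroup (FockIdx n × FockIdx n) ℂ,
    (∀ f, Uᴴ * field f * U = field (V *ᵥ f)) ∧ ρ' = Uᴴ * ρ * U

end FermionPair

end

open FermionPair

/-!
Why the theorem holds.

*Algebra.* The fields `B(f)` satisfy `B(f) B(g) + B(g) B(f) = ⟨Γ f, g⟩` and generate the full matrix
algebra on `ℋ ⊗ ℋ`, so a state is determined by its correlation functions, and a quasifree state by
its covariance (`eq_of_correlations`, `IsQuasifreeWith.unique`). Since correlations of odd order
vanish, a quasifree state commutes with the total parity. Two representations of the canonical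
anticommutation relations on the same space are unitarily equivalent (`IsCAR.exists_unitary`), which
gives unitary implementers of Bogolubov transformations (`IsBogolubov.exists_implementer`).

*The standard state.* The same equivalence yields a unitary `Ψ` on Fock space with
`iθ c Ψ = Ψ cᵀ` for all creation and annihilation operators `c`. Read as a vector of `ℋ ⊗ ℋ` and
normalized, `Ψ` is annihilated by `B(f)` for all `f` in the kernel of `P_st`, and moving the
annihilating part of the first field through a product proves Wick's theorem
(`isQuasifreeWith_of_split`). Unitarity of `Ψ` says that Alice's reduced state is totally mixed. For
even pure states this implies maximal entanglement (`isMaxEntangled_of_traceRight`), and it is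
preserved by local Bogolubov transformations (`traceRight_conj`).

*Classification.* A quasifree state `ρ` with covariance `S` obeys the exchange relation
`ρ B(S f) = B((1 - S) f) ρ` (`IsQuasifreeWith.mul_field`). For pure `ρ` both sides vanish, because
`ρ M ρ = tr(ρ M) ρ` and one-point functions are zero; hence `S² = S`. If `ρ` is maximally entangled,
Alice's reduced state is a combination of `1` and `θ`, and for `n ≥ 2` the parity `θ` is trace
orthogonal to products of two fields; so `S` has the Alice block `½`. A projection
`S = [[½, X], [X†, D]]` has `X X† = ¼` and `D = ½`, which makes `V_B = 2i X†` a Bogolubov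
transformation with `S = V P_st V†` for `V = 1 ⊕ V_B`.
-/

open FermionPair

noncomputable section

namespace FermionPair

variable {n : ℕ}

/-! ### Operators on the Fock space of one party -/

/-- The sign with which `c†ⱼ` acts on the basis vector `e_I`. -/
def jwSign (j : Fin n) (I : FockIdx n) : ℂ := (-1) ^ (I.filter (fun i => i < j)).card

lemma jwSign_mul_self (j : Fin n) (I : FockIdx n) : jwSign j I * jwSign j I = 1 := by
  simp [jwSign, ← mul_pow]

lemma jwSign_ne_zero (j : Fin n) (I : FockIdx n) : jwSign j I ≠ 0 := by simp [jwSign]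

lemma jwSign_insert (j k : Fin n) (I : FockIdx n) (hk : k ∉ I) :
    jwSign j (insert k I) = if k < j then -jwSign j I else jwSign j I := by
  unfold jwSign
  rw [Finset.filter_insert]
  split_ifs with h
  · rw [Finset.card_insert_of_notMem (by simp [hk]), pow_succ]; ring
  · rfl

lemma creation_apply (j : Fin n) (J I : FockIdx n) :
    creation j J I = if j ∉ I ∧ J = insert j I then jwSign j I else 0 := rfl

lemma annihilation_apply (j : Fin n) (J I : FockIdx n) :
    annihilation j J I = if j ∉ J ∧ I = insert j J then jwSign j J else 0 := by
  simp only [annihilation, Matrix.conjTranspose_apply, creation_apply]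
  split_ifs <;> simp [jwSign]

lemma conjTranspose_annihilation (j : Fin n) : (annihilation j)ᴴ = creation j := by
  simp [annihilation]

lemma transpose_annihilation (j : Fin n) : (annihilation j)ᵀ = creation j := by
  ext J I
  rw [Matrix.transpose_apply, annihilation_apply, creation_apply]

lemma mul_creation_apply (M : FockOp n) (k : Fin n) (J I : FockIdx n) :
    (M * creation k) J I = if k ∉ I then jwSign k I * M J (insert k I) else 0 := by
  rw [Matrix.mul_apply]
  by_cases h : k ∈ I
  · simp [creation_apply, h]
  · simp [creation_apply, h, mul_comm]

lemma annihilation_mul_apply (M : FockOp n) (k : Fin n) (J I : FockIdx n) :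
    (annihilation k * M) J I = if k ∉ J then jwSign k J * M (insert k J) I else 0 := by
  rw [Matrix.mul_apply]
  by_cases h : k ∈ J
  · simp [annihilation_apply, h]
  · simp [annihilation_apply, h]

lemma creation_anticomm (j k : Fin n) :
    creation j * creation k + creation k * creation j = 0 := by
  ext J I
  simp only [Matrix.add_apply, mul_creation_apply, creation_apply, Matrix.zero_apply]
  by_cases hjk : j = k
  · subst hjk; simp
  by_cases hj : j ∈ I
  · simp [hj]
  by_cases hk : k ∈ I
  · simp [hk]
  have hkj : ¬ k = j := fun h => hjk h.symm
  rw [Finset.insert_comm k j]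
  simp only [hj, hk, hjk, hkj, Finset.mem_insert, or_self, not_false_eq_true, true_and, if_true]
  rw [jwSign_insert j k I hk, jwSign_insert k j I hj]
  rcases lt_or_gt_of_ne hjk with h | h
  · rw [if_neg h.not_gt, if_pos h]; split_ifs <;> ring
  · rw [if_neg h.not_gt, if_pos h]; split_ifs <;> ring

lemma annihilation_anticomm (j k : Fin n) :
    annihilation j * annihilation k + annihilation k * annihilation j = 0 := by
  have := congrArg Matrix.conjTranspose (creation_anticomm k j)
  simpa [annihilation, Matrix.conjTranspose_mul] using this

lemma annihilation_creation_anticomm (j k : Fin n) :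
    annihilation j * creation k + creation k * annihilation j = if j = k then 1 else 0 := by
  ext J I
  have hL : (creation k * annihilation j) J I =
      if k ∈ J ∧ j ∈ I ∧ J.erase k = I.erase j
        then jwSign k (J.erase k) * jwSign j (I.erase j) else 0 := by
    rw [Matrix.mul_apply]
    by_cases hk : k ∈ J
    · rw [Finset.sum_eq_single (J.erase k)]
      · rw [creation_apply, annihilation_apply]
        by_cases hj : j ∈ I
        · by_cases h : J.erase k = I.erase j
          · rw [if_pos ⟨Finset.notMem_erase k J, (Finset.insert_erase hk).symm⟩,
              if_pos ⟨by rw [h]; exact Finset.notMem_erase j I, by rw [h, Finset.insert_erase hj]⟩,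
              if_pos ⟨hk, hj, h⟩, h]
          · have : ¬ (j ∉ J.erase k ∧ I = insert j (J.erase k)) := by
              rintro ⟨h1, h2⟩; apply h; rw [h2, Finset.erase_insert h1]
            rw [if_neg this]; simp [h]
        · have : ¬ (j ∉ J.erase k ∧ I = insert j (J.erase k)) := by
              rintro ⟨h1, h2⟩; apply hj; rw [h2]; simp
          rw [if_neg this]; simp [hj]
      · intro K _ hK
        rw [creation_apply, if_neg, zero_mul]
        rintro ⟨h1, h2⟩; apply hK; rw [h2, Finset.erase_insert h1]
      · simp
    · rw [if_neg (by simp [hk])]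
      apply Finset.sum_eq_zero
      intro K _
      rw [creation_apply, if_neg, zero_mul]
      rintro ⟨h1, h2⟩; apply hk; rw [h2]; simp
  rw [Matrix.add_apply, hL, annihilation_mul_apply, creation_apply]
  by_cases hjk : j = k
  · subst hjk
    simp only [if_true, Matrix.one_apply]
    by_cases hJI : J = I
    · subst hJI
      by_cases hj : j ∈ J <;> simp [hj, jwSign_mul_self]
    · rw [if_neg hJI]
      have h1 : ¬ (j ∈ J ∧ j ∈ I ∧ J.erase j = I.erase j) := by
        rintro ⟨a, b, c⟩; apply hJI
        rw [← Finset.insert_erase a, c, Finset.insert_erase b]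
      rw [if_neg h1]
      by_cases hj : j ∈ J
      · simp [hj]
      · by_cases hI : j ∈ I
        · simp [hI]
        · have : ¬ (insert j J = insert j I) := fun h => hJI (by
            rw [← Finset.erase_insert hj, h, Finset.erase_insert hI])
          simp [hI, this]
  · have hkj : ¬ k = j := fun h => hjk h.symm
    rw [if_neg hjk, Matrix.zero_apply]
    -- the two terms are supported on the pairs `J = K ∪ {k}`, `I = K ∪ {j}` with `j, k ∉ K`
    by_cases hK : ∃ K : FockIdx n, j ∉ K ∧ k ∉ K ∧ J = insert k K ∧ I = insert j K
    · obtain ⟨K, h1, h2, rfl, rfl⟩ := hK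
      simp only [Finset.mem_insert, hjk, hkj, h1, h2, or_self, not_false_eq_true, if_true,
        Finset.erase_insert, true_or, true_and, Finset.insert_comm k j]
      rw [jwSign_insert j k K h2, jwSign_insert k j K h1]
      rcases lt_or_gt_of_ne hjk with h | h
      · rw [if_neg h.not_gt, if_pos h]; ring
      · rw [if_neg h.not_gt, if_pos h]; ring
    · have h1 : ¬ (k ∈ J ∧ j ∈ I ∧ J.erase k = I.erase j) := by
        rintro ⟨a, b, c⟩
        exact hK ⟨J.erase k, by rw [c]; simp, by simp, (Finset.insert_erase a).symm,
          by rw [c, Finset.insert_erase b]⟩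
      have h2 : ¬ (j ∉ J ∧ k ∉ I ∧ insert j J = insert k I) := by
        rintro ⟨a, b, c⟩
        have hkJ : k ∈ J := by
          have : k ∈ insert j J := by rw [c]; simp
          simpa [hkj] using this
        refine hK ⟨J.erase k, by simp [a], by simp, (Finset.insert_erase hkJ).symm, ?_⟩
        rw [← Finset.erase_insert b, ← c, Finset.erase_insert_of_ne hjk]
      rw [if_neg h1, add_zero]
      by_cases a : j ∈ J
      · simp [a]
      · have h3 : ¬ (k ∉ I ∧ insert j J = insert k I) := fun h => h2 ⟨a, h⟩
        rw [if_neg h3]; simp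

/-- The creation and annihilation operators in one family: `cⱼ` for `Sum.inl j` and `c†ⱼ` for
`Sum.inr j`. -/
def ladder (i : LocalIdx n) : FockOp n := Sum.elim annihilation creation i

lemma conjTranspose_ladder (i : LocalIdx n) : (ladder i)ᴴ = ladder i.swap := by
  rcases i with j | j <;> simp [ladder, annihilation]

lemma transpose_ladder (i : LocalIdx n) : (ladder i)ᵀ = ladder i.swap := by
  rcases i with j | j
  · simp [ladder, transpose_annihilation]
  · simp [ladder, ← transpose_annihilation]

lemma ladder_anticomm (i k : LocalIdx n) :
    ladder i * ladder k + ladder k * ladder i = if i = k.swap then 1 else 0 := by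
  rcases i with j | j <;> rcases k with k | k
  · simpa [ladder] using annihilation_anticomm j k
  · simpa [ladder] using annihilation_creation_anticomm j k
  · rw [add_comm]; simpa [ladder, eq_comm] using annihilation_creation_anticomm k j
  · simpa [ladder] using creation_anticomm j k

lemma parityOp_mul_self : parityOp n * parityOp n = 1 := by
  simp [parityOp, Matrix.diagonal_mul_diagonal, ← mul_pow]

lemma conjTranspose_parityOp : (parityOp n)ᴴ = parityOp n := by
  simp [parityOp, Matrix.diagonal_conjTranspose, Pi.star_def]

lemma parityOp_mul_annihilation (j : Fin n) :
    parityOp n * annihilation j = -(annihilation j * parityOp n) := by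
  ext J I
  simp only [parityOp, Matrix.diagonal_mul, Matrix.mul_diagonal, Matrix.neg_apply,
    annihilation_apply]
  split_ifs with h
  · rw [h.2, Finset.card_insert_of_notMem h.1, pow_succ]; ring
  · simp

lemma parityOp_mul_ladder (i : LocalIdx n) :
    parityOp n * ladder i = -(ladder i * parityOp n) := by
  rcases i with j | j
  · exact parityOp_mul_annihilation j
  · have := congrArg Matrix.conjTranspose (parityOp_mul_annihilation j)
    simp only [Matrix.conjTranspose_mul, Matrix.conjTranspose_neg, conjTranspose_parityOp,
      conjTranspose_annihilation] at this
    simp only [ladder, Sum.elim_inr, this, neg_neg]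

/-- The creation and annihilation operators generate the algebra of all operators on Fock space. -/
lemma subalgebra_eq_top_of_ladder_mem (A : Subalgebra ℂ (FockOp n)) (h : ∀ i, ladder i ∈ A) :
    A = ⊤ := by
  have hann (j) : annihilation j ∈ A := h (Sum.inl j)
  have hcre (j) : creation j ∈ A := h (Sum.inr j)
  -- the occupation number operators are diagonal, and products of them and of their complements
  -- are the diagonal matrix units
  have hdiag (I : FockIdx n) : Matrix.single I I (1 : ℂ) ∈ A := by
    let D : Subalgebra ℂ (FockIdx n → ℂ) := A.comap (Matrix.diagonalAlgHom ℂ)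
    have hN (j : Fin n) : (fun I : FockIdx n => if j ∈ I then (1 : ℂ) else 0) ∈ D := by
      change Matrix.diagonal _ ∈ A
      have : Matrix.diagonal (fun I : FockIdx n => if j ∈ I then (1 : ℂ) else 0)
          = 1 - annihilation j * creation j := by
        ext J K
        rw [Matrix.sub_apply, annihilation_mul_apply, creation_apply, Matrix.diagonal_apply,
          Matrix.one_apply]
        by_cases hJK : J = K
        · subst hJK
          by_cases hj : j ∈ J <;> simp [hj, jwSign_mul_self]
        · by_cases hJ : j ∈ J
          · simp [hJK, hJ]
          · by_cases hK : j ∈ K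
            · simp [hJK, hK]
            · have : ¬ (insert j J = insert j K) := fun h => hJK (by
                rw [← Finset.erase_insert hJ, h, Finset.erase_insert hK])
              simp [hJK, this]
      rw [this]
      exact A.sub_mem A.one_mem (A.mul_mem (hann j) (hcre j))
    have hP : (∏ j : Fin n, fun J : FockIdx n => if (j ∈ J ↔ j ∈ I) then (1 : ℂ) else 0) ∈ D := by
      refine D.prod_mem fun j _ => ?_
      by_cases hj : j ∈ I
      · simpa [hj] using hN j
      · have := D.sub_mem D.one_mem (hN j)
        convert this using 1
        ext J
        by_cases hJ : j ∈ J <;> simp [hj, hJ]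
    change Matrix.diagonal _ ∈ A at hP
    convert hP using 1
    ext J K
    rw [Matrix.diagonal_apply, Matrix.single_apply, Finset.prod_apply]
    by_cases hJK : J = K
    · subst hJK
      by_cases hIJ : I = J
      · subst hIJ; simp
      · have : ∃ j, ¬ (j ∈ J ↔ j ∈ I) := by
          by_contra! hc; exact hIJ (Finset.ext fun j => (hc j).symm)
        obtain ⟨j, hj⟩ := this
        rw [if_neg (by simp [hIJ]), if_pos rfl]
        exact (Finset.prod_eq_zero (Finset.mem_univ j) (if_neg hj)).symm
    · rw [if_neg (by rintro ⟨rfl, rfl⟩; exact hJK rfl), if_neg hJK]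
  -- a nonzero matrix element of a member of `A` yields the corresponding matrix unit
  have hstep {I J : FockIdx n} {M : FockOp n} (hM : M ∈ A) (h0 : M I J ≠ 0) :
      Matrix.single I J (1 : ℂ) ∈ A := by
    have h1 := A.smul_mem (A.mul_mem (A.mul_mem (hdiag I) hM) (hdiag J)) (M I J)⁻¹
    rwa [Matrix.single_mul_mul_single, Matrix.smul_single, one_mul, mul_one, smul_eq_mul,
      inv_mul_cancel₀ h0] at h1
  -- every occupation set is reached from the vacuum by adding one particle at a time
  have hvac (I : FockIdx n) :
      Matrix.single I ∅ (1 : ℂ) ∈ A ∧ Matrix.single ∅ I (1 : ℂ) ∈ A := by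
    induction I using Finset.induction_on with
    | empty => exact ⟨hdiag ∅, hdiag ∅⟩
    | insert j I hj ih =>
      have h1 : Matrix.single (insert j I) I (1 : ℂ) ∈ A :=
        hstep (hcre j) (by simp [creation_apply, hj, jwSign_ne_zero])
      have h2 : Matrix.single I (insert j I) (1 : ℂ) ∈ A :=
        hstep (hann j) (by simp [annihilation_apply, hj, jwSign_ne_zero])
      constructor
      · simpa using A.mul_mem h1 ih.1
      · simpa using A.mul_mem ih.2 h2
  rw [eq_top_iff]
  intro M _
  rw [Matrix.matrix_eq_sum_single M]
  refine A.sum_mem fun I _ => A.sum_mem fun J _ => ?_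
  have := A.smul_mem (A.mul_mem (hvac I).1 (hvac J).2) (M I J)
  simpa using this

/-- Induction over all operators on Fock space, built from creation and annihilation operators. -/
lemma fockOp_induction {p : FockOp n → Prop} (hl : ∀ i, p (ladder i))
    (hs : ∀ c : ℂ, p (c • 1)) (ha : ∀ X Y, p X → p Y → p (X + Y))
    (hm : ∀ X Y, p X → p Y → p (X * Y)) (X : FockOp n) : p X := by
  let A : Subalgebra ℂ (FockOp n) :=
    { carrier := {X | p X}
      mul_mem' := fun {X Y} => hm X Y
      add_mem' := fun {X Y} => ha X Y
      algebraMap_mem' := fun c => by rw [Algebra.algebraMap_eq_smul_one]; exact hs c }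
  have : X ∈ A := by rw [subalgebra_eq_top_of_ladder_mem A hl]; trivial
  exact this

lemma exists_eq_smul_one_of_commute_single {X : Type*} [Fintype X] [DecidableEq X]
    {M : Matrix X X ℂ} (h : ∀ N, Commute N M) : ∃ c : ℂ, M = c • 1 := by
  obtain ⟨c, hc⟩ := Matrix.mem_range_scalar_of_commute_single (M := M) fun _ _ _ => h _
  exact ⟨c, by rw [← hc, Matrix.scalar_apply, Matrix.smul_one_eq_diagonal]⟩

/-! ### Representations of the canonical anticommutation relations -/

/-- Moving `a` through a product of elements whose anticommutators with `a` are scalars. -/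
lemma mul_prod_ofFn_of_anticomm {R : Type*} [Ring R] [Algebra ℂ R] (a : R) {m : ℕ}
    (b : Fin (m + 1) → R) (s : Fin (m + 1) → ℂ) (h : ∀ j, a * b j + b j * a = s j • (1 : R)) :
    a * (List.ofFn b).prod =
      ∑ j : Fin (m + 1), ((-1) ^ (j : ℕ) * s j) • (List.ofFn fun i => b (j.succAbove i)).prod
        + (-1 : ℂ) ^ (m + 1) • ((List.ofFn b).prod * a) := by
  induction m with
  | zero =>
    have := h 0
    simp only [List.ofFn_succ, List.ofFn_zero, List.prod_cons, List.prod_nil, mul_one]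
    simp [← this]
  | succ m ih =>
    have h0 : a * b 0 = s 0 • 1 - b 0 * a := by rw [← h 0]; abel
    have ih' := ih (fun i => b i.succ) (fun i => s i.succ) (fun i => h i.succ)
    have hterm (j : Fin (m + 1)) :
        (List.ofFn fun i => b (j.succ.succAbove i)).prod
          = b 0 * (List.ofFn fun i => b (j.succAbove i).succ).prod := by
      rw [List.ofFn_succ, List.prod_cons]
      simp [Fin.succ_succAbove_succ]
    rw [Fin.sum_univ_succ, List.ofFn_succ, List.prod_cons, ← mul_assoc, h0, sub_mul,
      mul_assoc (b 0) a, ih']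
    simp only [hterm, mul_add, Finset.mul_sum, mul_smul_comm, Fin.succAbove_zero, Fin.val_succ,
      pow_succ, Fin.val_zero, pow_zero, one_mul, smul_mul_assoc, mul_assoc]
    simp only [neg_mul, mul_neg, one_mul, mul_one, neg_smul, Finset.sum_neg_distrib]
    abel

section Intertwiner

variable {X ι κ : Type*} {a : κ → Matrix X X ℂ}

/-- The selfadjoint (Majorana) operators `a + a†` and `i (a - a†)` of a family `a` of annihilation
operators. -/
def majorana (a : κ → Matrix X X ℂ) : κ ⊕ κ → Matrix X X ℂ :=
  Sum.elim (fun k => a k + (a k)ᴴ) (fun k => Complex.I • (a k - (a k)ᴴ))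

lemma conjTranspose_majorana (k : κ ⊕ κ) : (majorana a k)ᴴ = majorana a k := by
  rcases k with k | k
  · simp [majorana, add_comm]
  · simp [majorana, ← smul_neg, neg_sub]

lemma eq_majorana (k : κ) :
    a k = (1 / 2 : ℂ) • (majorana a (Sum.inl k) - Complex.I • majorana a (Sum.inr k)) := by
  simp only [majorana, Sum.elim_inl, Sum.elim_inr, smul_smul, Complex.I_mul_I, neg_smul, one_smul]
  module

lemma conjTranspose_eq_majorana (k : κ) :
    (a k)ᴴ = (1 / 2 : ℂ) • (majorana a (Sum.inl k) + Complex.I • majorana a (Sum.inr k)) := by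
  simp only [majorana, Sum.elim_inl, Sum.elim_inr, smul_smul, Complex.I_mul_I, neg_smul, one_smul]
  module

variable [Fintype X] [DecidableEq X]

/-- Two families `γ`, `γ'` of anticommuting involutions on a common space are intertwined by a
nonzero matrix, if some invertible `θ` anticommutes with all members of `γ'`. The maps
`M ↦ γ'ₖ M γₖ` are commuting involutions, and `M ↦ γ'ₖ θ M` flips the sign of the eigenvalue of
exactly the `k`-th one; so a common fixed vector exists. -/
lemma exists_ne_zero_intertwining [Nonempty X] [Finite ι] (γ γ' : ι → Matrix X X ℂ)
    (θ : Matrix X X ℂ)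
    (hθ : θ * θ = 1) (hθγ : ∀ k, θ * γ' k = -(γ' k * θ))
    (hγ : ∀ k, γ k * γ k = 1) (hγ' : ∀ k, γ' k * γ' k = 1)
    (hγa : ∀ k l, k ≠ l → γ k * γ l = -(γ l * γ k))
    (hγa' : ∀ k l, k ≠ l → γ' k * γ' l = -(γ' l * γ' k)) :
    ∃ M : Matrix X X ℂ, M ≠ 0 ∧ ∀ k, γ' k * M = M * γ k := by
  classical
  have := Fintype.ofFinite ι
  have key (s : Finset ι) : ∃ M : Matrix X X ℂ, M ≠ 0 ∧ ∀ k ∈ s, γ' k * M * γ k = M := by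
    induction s using Finset.induction_on with
    | empty => exact ⟨1, one_ne_zero, by simp⟩
    | insert m s hm ih =>
      obtain ⟨M, hM0, hM⟩ := ih
      have hne {k} (hk : k ∈ s) : k ≠ m := fun h => hm (h ▸ hk)
      by_cases hsum : M + γ' m * M * γ m = 0
      · -- `M` has eigenvalue `-1` at `m`, and `γ' m * θ` flips that sign only
        have hMm : γ' m * M * γ m = -M := by rw [eq_neg_iff_add_eq_zero, add_comm]; exact hsum
        refine ⟨γ' m * θ * M, fun h => hM0 ?_, fun k hk => ?_⟩
        · have : θ * (γ' m * (γ' m * θ * M)) = M := by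
            rw [← mul_assoc (γ' m), ← mul_assoc (γ' m), hγ', one_mul, ← mul_assoc, hθ, one_mul]
          rw [← this, h, mul_zero, mul_zero]
        · rcases Finset.mem_insert.1 hk with rfl | hk
          · calc γ' k * (γ' k * θ * M) * γ k = γ' k * (γ' k * θ) * M * γ k := by noncomm_ring
              _ = -(γ' k * (θ * γ' k) * M * γ k) := by rw [hθγ k]; noncomm_ring
              _ = -(γ' k * θ * (γ' k * M * γ k)) := by noncomm_ring
              _ = γ' k * θ * M := by rw [hMm]; noncomm_ring
          · calc γ' k * (γ' m * θ * M) * γ k = (γ' k * γ' m) * θ * M * γ k := by noncomm_ring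
              _ = -(γ' m * (γ' k * θ) * M * γ k) := by rw [hγa' k m (hne hk)]; noncomm_ring
              _ = γ' m * θ * (γ' k * M * γ k) := by
                rw [← neg_eq_iff_eq_neg.2 (hθγ k)]; noncomm_ring
              _ = γ' m * θ * M := by rw [hM k hk]
      · refine ⟨_, hsum, fun k hk => ?_⟩
        rcases Finset.mem_insert.1 hk with rfl | hk
        · calc γ' k * (M + γ' k * M * γ k) * γ k
              = γ' k * M * γ k + (γ' k * γ' k) * M * (γ k * γ k) := by noncomm_ring
            _ = M + γ' k * M * γ k := by rw [hγ, hγ']; noncomm_ring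
        · calc γ' k * (M + γ' m * M * γ m) * γ k
              = γ' k * M * γ k + (γ' k * γ' m) * M * (γ m * γ k) := by noncomm_ring
            _ = γ' k * M * γ k + γ' m * (γ' k * M * γ k) * γ m := by
              rw [hγa' k m (hne hk), hγa m k (hne hk).symm]; noncomm_ring
            _ = M + γ' m * M * γ m := by rw [hM k hk]
  obtain ⟨M, hM0, hM⟩ := key Finset.univ
  refine ⟨M, hM0, fun k => ?_⟩
  conv_rhs => rw [← hM k (Finset.mem_univ k)]
  rw [mul_assoc, hγ, mul_one]

/-- A nonzero intertwiner of selfadjoint families is a multiple of a unitary, if the source is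
irreducible (Schur's lemma). -/
lemma exists_unitary_intertwining (γ γ' : ι → Matrix X X ℂ)
    (hγ : ∀ k, (γ k)ᴴ = γ k) (hγ' : ∀ k, (γ' k)ᴴ = γ' k)
    (hirr : ∀ M, (∀ k, γ k * M = M * γ k) → ∃ c : ℂ, M = c • 1)
    (M : Matrix X X ℂ) (hM0 : M ≠ 0) (hM : ∀ k, γ' k * M = M * γ k) :
    ∃ U ∈ Matrix.unitaryGroup X ℂ, ∀ k, γ' k * U = U * γ k := by
  obtain ⟨c, hc⟩ := hirr (Mᴴ * M) fun k => by
    have h := congrArg Matrix.conjTranspose (hM k)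
    rw [Matrix.conjTranspose_mul, Matrix.conjTranspose_mul, hγ, hγ'] at h
    rw [← mul_assoc, ← h, mul_assoc, hM, mul_assoc]
  obtain ⟨i, j, hij⟩ : ∃ i j, M i j ≠ 0 := by
    by_contra! h; exact hM0 (Matrix.ext h)
  have hcj : c = ∑ x, (((‖M x j‖ ^ 2 : ℝ)) : ℂ) := by
    have := congrFun (congrFun hc j) j
    rw [Matrix.smul_apply, Matrix.one_apply_eq, smul_eq_mul, mul_one, Matrix.mul_apply] at this
    rw [← this]
    refine Finset.sum_congr rfl fun x _ => ?_
    rw [Matrix.conjTranspose_apply, ← Complex.normSq_eq_norm_sq, Complex.normSq_eq_conj_mul_self]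
    rfl
  set r : ℝ := ∑ x, ‖M x j‖ ^ 2 with hr
  have hrpos : 0 < r :=
    Finset.sum_pos' (fun _ _ => by positivity) ⟨i, Finset.mem_univ i, by positivity⟩
  have hcr : c = (r : ℂ) := by rw [hcj, hr]; push_cast; rfl
  have hs : ((Real.sqrt r : ℝ) : ℂ) * (Real.sqrt r : ℝ) = r := by
    rw [← Complex.ofReal_mul, Real.mul_self_sqrt hrpos.le]
  have hs0 : ((Real.sqrt r : ℝ) : ℂ) ≠ 0 := by
    rw [Complex.ofReal_ne_zero]; exact (Real.sqrt_pos.2 hrpos).ne'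
  refine ⟨((Real.sqrt r : ℝ) : ℂ)⁻¹ • M, ?_, fun k => ?_⟩
  · rw [Matrix.mem_unitaryGroup_iff', Matrix.star_eq_conjTranspose, Matrix.conjTranspose_smul,
      Matrix.smul_mul, Matrix.mul_smul, hc, smul_smul, smul_smul, hcr, ← hs]
    have : star ((Real.sqrt r : ℂ)⁻¹) = (Real.sqrt r : ℂ)⁻¹ := by
      rw [star_inv₀]; simp
    rw [this]
    field_simp
    simp
  · rw [Matrix.mul_smul, Matrix.smul_mul, hM]

/-- The canonical anticommutation relations for annihilation operators `a`; the relations between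
two creation operators follow by taking adjoints. -/
structure IsCAR [DecidableEq κ] (a : κ → Matrix X X ℂ) : Prop where
  anticomm : ∀ j k, a j * a k + a k * a j = 0
  anticomm_adjoint : ∀ j k, a j * (a k)ᴴ + (a k)ᴴ * a j = if j = k then 1 else 0

lemma mul_majorana {θ : Matrix X X ℂ} (hθs : θᴴ = θ) (hθ : ∀ k, θ * a k = -(a k * θ))
    (k : κ ⊕ κ) : θ * majorana a k = -(majorana a k * θ) := by
  have h' (k) : θ * (a k)ᴴ = -((a k)ᴴ * θ) := by
    have := congrArg Matrix.conjTranspose (hθ k)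
    simp only [Matrix.conjTranspose_mul, Matrix.conjTranspose_neg, hθs] at this
    rw [this, neg_neg]
  rcases k with k | k
  · simp only [majorana, Sum.elim_inl, mul_add, add_mul, hθ, h']; abel
  · simp only [majorana, Sum.elim_inr, Matrix.mul_smul, Matrix.smul_mul, mul_sub, sub_mul, hθ, h']
    module

variable [DecidableEq κ]

lemma IsCAR.majorana_anticomm (h : IsCAR a) (k l : κ ⊕ κ) :
    majorana a k * majorana a l + majorana a l * majorana a k = if k = l then (2 : ℂ) • 1 else 0 := by
  have h1 := h.anticomm
  have h2 := h.anticomm_adjoint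
  have h3 (j k) : (a j)ᴴ * (a k)ᴴ + (a k)ᴴ * (a j)ᴴ = 0 := by
    have := congrArg Matrix.conjTranspose (h1 k j)
    simpa [Matrix.conjTranspose_mul] using this
  have I2 : Complex.I * Complex.I = -1 := Complex.I_mul_I
  rcases k with k | k <;> rcases l with l | l <;>
    simp only [majorana, Sum.elim_inl, Sum.elim_inr, Sum.inl.injEq, Sum.inr.injEq, reduceCtorEq,
      if_false]
  · have e : (a k + (a k)ᴴ) * (a l + (a l)ᴴ) + (a l + (a l)ᴴ) * (a k + (a k)ᴴ)
      = (a k * a l + a l * a k) + ((a k)ᴴ * (a l)ᴴ + (a l)ᴴ * (a k)ᴴ)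
        + (a k * (a l)ᴴ + (a l)ᴴ * a k) + (a l * (a k)ᴴ + (a k)ᴴ * a l) := by noncomm_ring
    rw [e, h1, h3, h2, h2]
    by_cases hkl : k = l
    · subst hkl; simp only [if_true]; module
    · simp [hkl, Ne.symm hkl]
  · have e : (a k + (a k)ᴴ) * (Complex.I • (a l - (a l)ᴴ))
        + (Complex.I • (a l - (a l)ᴴ)) * (a k + (a k)ᴴ)
      = Complex.I • ((a k * a l + a l * a k) - ((a k)ᴴ * (a l)ᴴ + (a l)ᴴ * (a k)ᴴ)
        - (a k * (a l)ᴴ + (a l)ᴴ * a k) + (a l * (a k)ᴴ + (a k)ᴴ * a l)) := by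
      rw [Matrix.mul_smul, Matrix.smul_mul, ← smul_add]; congr 1; noncomm_ring
    rw [e, h1, h3, h2, h2]
    by_cases hkl : k = l
    · subst hkl; simp
    · simp [hkl, Ne.symm hkl]
  · have e : (Complex.I • (a k - (a k)ᴴ)) * (a l + (a l)ᴴ)
        + (a l + (a l)ᴴ) * (Complex.I • (a k - (a k)ᴴ))
      = Complex.I • ((a k * a l + a l * a k) - ((a k)ᴴ * (a l)ᴴ + (a l)ᴴ * (a k)ᴴ)
        + (a k * (a l)ᴴ + (a l)ᴴ * a k) - (a l * (a k)ᴴ + (a k)ᴴ * a l)) := by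
      rw [Matrix.mul_smul, Matrix.smul_mul, ← smul_add]; congr 1; noncomm_ring
    rw [e, h1, h3, h2, h2]
    by_cases hkl : k = l
    · subst hkl; simp
    · simp [hkl, Ne.symm hkl]
  · have e : (Complex.I • (a k - (a k)ᴴ)) * (Complex.I • (a l - (a l)ᴴ))
        + (Complex.I • (a l - (a l)ᴴ)) * (Complex.I • (a k - (a k)ᴴ))
      = (Complex.I * Complex.I) • ((a k * a l + a l * a k) + ((a k)ᴴ * (a l)ᴴ + (a l)ᴴ * (a k)ᴴ)
        - (a k * (a l)ᴴ + (a l)ᴴ * a k) - (a l * (a k)ᴴ + (a k)ᴴ * a l)) := by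
      rw [Matrix.mul_smul, Matrix.smul_mul, Matrix.mul_smul, Matrix.smul_mul, smul_smul,
        smul_smul, ← smul_add]
      congr 1; noncomm_ring
    rw [e, h1, h3, h2, h2, I2]
    by_cases hkl : k = l
    · subst hkl; simp only [if_true]; module
    · simp [hkl, Ne.symm hkl]

lemma IsCAR.majorana_mul_self (h : IsCAR a) (k : κ ⊕ κ) : majorana a k * majorana a k = 1 := by
  have := h.majorana_anticomm k k
  rw [if_pos rfl, ← two_smul ℂ] at this
  exact smul_right_injective _ (two_ne_zero (α := ℂ)) this

lemma IsCAR.majorana_mul_comm (h : IsCAR a) {k l : κ ⊕ κ} (hkl : k ≠ l) :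
    majorana a k * majorana a l = -(majorana a l * majorana a k) := by
  rw [eq_neg_iff_add_eq_zero, h.majorana_anticomm, if_neg hkl]

/-- Uniqueness of the irreducible representation of the canonical anticommutation relations. The
representations live on the same space, and an operator `θ` plays the role of the parity. -/
lemma IsCAR.exists_unitary [Nonempty X] [Finite κ] {a' : κ → Matrix X X ℂ} (h : IsCAR a)
    (h' : IsCAR a')
    (hirr : ∀ M, (∀ k, a k * M = M * a k) → (∀ k, (a k)ᴴ * M = M * (a k)ᴴ) → ∃ c : ℂ, M = c • 1)
    (θ : Matrix X X ℂ) (hθs : θᴴ = θ) (hθ : θ * θ = 1) (hθa : ∀ k, θ * a' k = -(a' k * θ)) :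
    ∃ U ∈ Matrix.unitaryGroup X ℂ, ∀ k, a' k * U = U * a k ∧ (a' k)ᴴ * U = U * (a k)ᴴ := by
  obtain ⟨M, hM0, hM⟩ := exists_ne_zero_intertwining (majorana a) (majorana a') θ hθ
    (mul_majorana hθs hθa) h.majorana_mul_self h'.majorana_mul_self
    (fun k l => h.majorana_mul_comm) (fun k l => h'.majorana_mul_comm)
  obtain ⟨U, hU, hUγ⟩ := exists_unitary_intertwining (majorana a) (majorana a')
    conjTranspose_majorana conjTranspose_majorana (fun M hM => hirr M
      (fun k => by
        rw [eq_majorana (a := a) k, Matrix.smul_mul, Matrix.mul_smul, sub_mul, mul_sub, Matrix.smul_mul,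
          Matrix.mul_smul, hM, hM])
      (fun k => by
        rw [conjTranspose_eq_majorana (a := a) k, Matrix.smul_mul, Matrix.mul_smul, add_mul, mul_add,
          Matrix.smul_mul, Matrix.mul_smul, hM, hM])) M hM0 hM
  refine ⟨U, hU, fun k => ⟨?_, ?_⟩⟩
  · rw [eq_majorana (a := a') k, eq_majorana (a := a) k, Matrix.smul_mul, Matrix.mul_smul, sub_mul, mul_sub,
      Matrix.smul_mul, Matrix.mul_smul, hUγ, hUγ]
  · rw [conjTranspose_eq_majorana (a := a') k, conjTranspose_eq_majorana (a := a) k, Matrix.smul_mul,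
      Matrix.mul_smul, add_mul, mul_add, Matrix.smul_mul, Matrix.mul_smul, hUγ, hUγ]

end Intertwiner

/-! ### The fields of both parties -/

/-- The field operators `∑ⱼ f⁺ⱼ cⱼ + f⁻ⱼ c†ⱼ` of a single party. -/
def localField (f : LocalIdx n → ℂ) : FockOp n := ∑ i, f i • ladder i

lemma localField_single (i : LocalIdx n) : localField (Pi.single i 1) = ladder i := by
  simp [localField, Pi.single_apply]

lemma parityOp_mul_localField (f : LocalIdx n → ℂ) :
    parityOp n * localField f = -(localField f * parityOp n) := by
  simp only [localField, Finset.mul_sum, Finset.sum_mul, Matrix.mul_smul, Matrix.smul_mul,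
    parityOp_mul_ladder, smul_neg, Finset.sum_neg_distrib]

lemma localField_anticomm (f g : LocalIdx n → ℂ) :
    localField f * localField g + localField g * localField f
      = (∑ i, f i.swap * g i) • (1 : FockOp n) := by
  have e (f g : LocalIdx n → ℂ) : localField f * localField g
      = ∑ i, ∑ k, (f i * g k) • (ladder i * ladder k) := by
    simp only [localField, Finset.mul_sum, Finset.sum_mul, Matrix.mul_smul, Matrix.smul_mul,
      smul_smul]
    rw [Finset.sum_comm]
    simp only [mul_comm]
  rw [e f g, e g f, Finset.sum_comm, ← Finset.sum_add_distrib, Finset.sum_smul]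
  refine Finset.sum_congr rfl fun k _ => ?_
  rw [← Finset.sum_add_distrib, Finset.sum_eq_single k.swap]
  · rw [mul_comm (g k), ← smul_add, ladder_anticomm, if_pos rfl]
  · intro i _ hi
    rw [mul_comm (g k), ← smul_add, ladder_anticomm, if_neg hi, smul_zero]
  · simp

lemma conjTranspose_localField (f : LocalIdx n → ℂ) :
    (localField f)ᴴ = localField (localConj f) := by
  simp only [localField, Matrix.conjTranspose_sum, Matrix.conjTranspose_smul, conjTranspose_ladder]
  refine Fintype.sum_equiv (Equiv.sumComm _ _) _ _ fun i => ?_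
  simp [localConj]

lemma trace_mul_kronecker_one {X Y : Type*} [Fintype X] [Fintype Y] [DecidableEq Y]
    (ρ : Matrix (X × Y) (X × Y) ℂ) (M : Matrix X X ℂ) :
    (ρ * (M ⊗ₖ (1 : Matrix Y Y ℂ))).trace = (traceRight ρ * M).trace := by
  simp only [Matrix.trace, Matrix.diag_apply, Matrix.mul_apply, Fintype.sum_prod_type,
    Matrix.kroneckerMap_apply, Matrix.one_apply, traceRight, Matrix.of_apply, mul_ite, mul_one,
    mul_zero, Finset.sum_ite_eq', Finset.mem_univ, if_true, Finset.sum_mul]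
  refine Finset.sum_congr rfl fun x _ => ?_
  rw [Finset.sum_comm]

lemma field_eq (f : GlobalIdx n → ℂ) :
    field f = localField (fun i => f (Sum.inl i)) ⊗ₖ (1 : FockOp n)
      + parityOp n ⊗ₖ localField (fun i => f (Sum.inr i)) := by
  have e (g : LocalIdx n → ℂ) : localField g
      = ∑ j, (g (Sum.inl j) • annihilation j + g (Sum.inr j) • creation j) := by
    rw [localField, Fintype.sum_sum_type, ← Finset.sum_add_distrib]; rfl
  have hl (F : Fin n → FockOp n) : (∑ j, F j) ⊗ₖ (1 : FockOp n) = ∑ j, F j ⊗ₖ (1 : FockOp n) := by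
    ext; simp [Matrix.sum_apply, Finset.sum_mul]
  have hr (F : Fin n → FockOp n) : parityOp n ⊗ₖ (∑ j, F j) = ∑ j, parityOp n ⊗ₖ F j := by
    ext; simp [Matrix.sum_apply, Finset.mul_sum]
  rw [e, e, hl, hr, ← Finset.sum_add_distrib, field]
  refine Finset.sum_congr rfl fun j _ => ?_
  simp only [annihilationA, annihilationB, Matrix.conjTranspose_kronecker, conjTranspose_parityOp,
    conjTranspose_annihilation, Matrix.conjTranspose_one, Matrix.add_kronecker,
    Matrix.kronecker_add, Matrix.smul_kronecker, Matrix.kronecker_smul]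
  abel

/-- The field operators, as a linear map. -/
def fieldLin (n : ℕ) : (GlobalIdx n → ℂ) →ₗ[ℂ] PairOp n where
  toFun := field
  map_add' f g := by
    simp only [field, Pi.add_apply, add_smul, ← Finset.sum_add_distrib]
    exact Finset.sum_congr rfl fun j _ => by abel
  map_smul' c f := by
    simp only [field, Pi.smul_apply, smul_eq_mul, mul_smul, Finset.smul_sum, smul_add,
      RingHom.id_apply]

lemma field_add (f g : GlobalIdx n → ℂ) : field (f + g) = field f + field g :=
  (fieldLin n).map_add f g

lemma field_mulVec_eq_sum (V : Matrix (GlobalIdx n) (GlobalIdx n) ℂ) (f : GlobalIdx n → ℂ) :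
    field (V *ᵥ f) = ∑ i, f i • field (V *ᵥ Pi.single i 1) := by
  have : f = ∑ i, f i • (Pi.single i 1 : GlobalIdx n → ℂ) := by
    ext j; simp [Finset.sum_apply, Pi.single_apply]
  conv_lhs => rw [this, ← Matrix.mulVecLin_apply]
  change fieldLin n (V.mulVecLin _) = _
  rw [map_sum, map_sum]
  refine Finset.sum_congr rfl fun i _ => ?_
  rw [map_smul, map_smul]
  rfl

lemma field_eq_sum (f : GlobalIdx n → ℂ) : field f = ∑ i, f i • field (Pi.single i 1) := by
  simpa only [Matrix.one_mulVec] using field_mulVec_eq_sum 1 f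

/-- Exchange of the components `f⁺ⱼ` and `f⁻ⱼ`. -/
def swapIdx (i : GlobalIdx n) : GlobalIdx n := Sum.map Sum.swap Sum.swap i

@[simp] lemma swapIdx_swapIdx (i : GlobalIdx n) : swapIdx (swapIdx i) = i := by
  rcases i with (i | i) | (i | i) <;> rfl

lemma globalConj_apply (f : GlobalIdx n → ℂ) (i : GlobalIdx n) :
    globalConj f i = star (f (swapIdx i)) := by
  rcases i with i | i <;> rfl

lemma twoPoint_eq (S : Matrix (GlobalIdx n) (GlobalIdx n) ℂ) (f g : GlobalIdx n → ℂ) :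
    twoPoint S f g = (fun i => f (swapIdx i)) ⬝ᵥ (S *ᵥ g) := by
  simp [twoPoint, dotProduct, globalConj_apply]

lemma twoPoint_single (S : Matrix (GlobalIdx n) (GlobalIdx n) ℂ) (i k : GlobalIdx n) :
    twoPoint S (Pi.single i 1) (Pi.single k 1) = S (swapIdx i) k := by
  rw [twoPoint_eq, Matrix.mulVec_single_one]
  have : (fun j => (Pi.single i 1 : GlobalIdx n → ℂ) (swapIdx j)) = Pi.single (swapIdx i) 1 := by
    ext j
    simp only [Pi.single_apply]
    congr 1
    exact propext ⟨fun h => by rw [← h]; simp, fun h => by rw [h]; simp⟩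
  rw [this, single_one_dotProduct]; rfl

lemma field_anticomm (f g : GlobalIdx n → ℂ) :
    field f * field g + field g * field f = twoPoint 1 f g • (1 : PairOp n) := by
  have h : twoPoint 1 f g = (∑ i, f (Sum.inl (Sum.swap i)) * g (Sum.inl i))
      + ∑ i, f (Sum.inr (Sum.swap i)) * g (Sum.inr i) := by
    rw [twoPoint_eq, Matrix.one_mulVec, dotProduct, Fintype.sum_sum_type]; rfl
  have e (f g : GlobalIdx n → ℂ) : field f * field g
      = (localField (fun i => f (Sum.inl i)) * localField (fun i => g (Sum.inl i))) ⊗ₖ (1 : FockOp n)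
        + (1 : FockOp n) ⊗ₖ (localField (fun i => f (Sum.inr i)) * localField (fun i => g (Sum.inr i)))
        + (localField (fun i => f (Sum.inl i)) * parityOp n) ⊗ₖ localField (fun i => g (Sum.inr i))
        - (localField (fun i => g (Sum.inl i)) * parityOp n) ⊗ₖ localField (fun i => f (Sum.inr i)) := by
    rw [field_eq, field_eq, add_mul, mul_add, mul_add]
    simp only [← Matrix.mul_kronecker_mul, one_mul, mul_one, parityOp_mul_self,
      parityOp_mul_localField]
    ext; simp; ring
  rw [e, e, h, add_smul]
  have hA := congrArg (fun M => M ⊗ₖ (1 : FockOp n)) (localField_anticomm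
    (fun i => f (Sum.inl i)) (fun i => g (Sum.inl i)))
  have hB := congrArg (fun M => (1 : FockOp n) ⊗ₖ M) (localField_anticomm
    (fun i => f (Sum.inr i)) (fun i => g (Sum.inr i)))
  simp only [Matrix.add_kronecker, Matrix.kronecker_add, Matrix.smul_kronecker,
    Matrix.kronecker_smul, Matrix.one_kronecker_one] at hA hB
  rw [← hA, ← hB]
  abel

lemma conjTranspose_field (f : GlobalIdx n → ℂ) : (field f)ᴴ = field (globalConj f) := by
  rw [field_eq, field_eq, Matrix.conjTranspose_add, Matrix.conjTranspose_kronecker,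
    Matrix.conjTranspose_kronecker, conjTranspose_localField, conjTranspose_localField,
    conjTranspose_parityOp, Matrix.conjTranspose_one]
  rfl

/-- The total parity `θ ⊗ θ`. -/
def totalParity (n : ℕ) : PairOp n := parityOp n ⊗ₖ parityOp n

lemma totalParity_mul_self : totalParity n * totalParity n = 1 := by
  rw [totalParity, ← Matrix.mul_kronecker_mul, parityOp_mul_self, Matrix.one_kronecker_one]

lemma conjTranspose_totalParity : (totalParity n)ᴴ = totalParity n := by
  rw [totalParity, Matrix.conjTranspose_kronecker, conjTranspose_parityOp]

lemma totalParity_mul_field (f : GlobalIdx n → ℂ) :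
    totalParity n * field f = -(field f * totalParity n) := by
  rw [field_eq, totalParity, mul_add, add_mul]
  simp only [← Matrix.mul_kronecker_mul, parityOp_mul_localField, one_mul, mul_one]
  ext; simp; ring

lemma field_inl_single (i : LocalIdx n) :
    field (Pi.single (Sum.inl i) 1) = ladder i ⊗ₖ (1 : FockOp n) := by
  rw [field_eq, ← localField_single i]
  have h1 : (fun k => (Pi.single (Sum.inl i) 1 : GlobalIdx n → ℂ) (Sum.inl k)) = Pi.single i 1 := by
    ext k; simp [Pi.single_apply]
  have h2 : localField (fun k => (Pi.single (Sum.inl i) 1 : GlobalIdx n → ℂ) (Sum.inr k)) = 0 := by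
    simp [localField]
  rw [h1, h2, Matrix.kronecker_zero, add_zero]

lemma field_inr_single (i : LocalIdx n) :
    field (Pi.single (Sum.inr i) 1) = parityOp n ⊗ₖ ladder i := by
  rw [field_eq, ← localField_single i]
  have h1 : (fun k => (Pi.single (Sum.inr i) 1 : GlobalIdx n → ℂ) (Sum.inr k)) = Pi.single i 1 := by
    ext k; simp [Pi.single_apply]
  have h2 : localField (fun k => (Pi.single (Sum.inr i) 1 : GlobalIdx n → ℂ) (Sum.inl k)) = 0 := by
    simp [localField]
  rw [h1, h2, Matrix.zero_kronecker, zero_add]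

/-- The fields generate the global fermion algebra. -/
lemma subalgebra_eq_top_of_field_mem (A : Subalgebra ℂ (PairOp n)) (h : ∀ f, field f ∈ A) :
    A = ⊤ := by
  have hA (M : FockOp n) : M ⊗ₖ (1 : FockOp n) ∈ A := by
    refine fockOp_induction (p := fun M => M ⊗ₖ (1 : FockOp n) ∈ A) (fun i => ?_) (fun c => ?_)
      (fun M N hM hN => ?_) (fun M N hM hN => ?_) M
    · rw [← field_inl_single]; exact h _
    · rw [Matrix.smul_kronecker, Matrix.one_kronecker_one]; exact A.smul_mem A.one_mem c
    · rw [Matrix.add_kronecker]; exact A.add_mem hM hN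
    · have := A.mul_mem hM hN
      rwa [← Matrix.mul_kronecker_mul, one_mul] at this
  have hB (M : FockOp n) : (1 : FockOp n) ⊗ₖ M ∈ A := by
    refine fockOp_induction (p := fun M => (1 : FockOp n) ⊗ₖ M ∈ A) (fun i => ?_) (fun c => ?_)
      (fun M N hM hN => ?_) (fun M N hM hN => ?_) M
    · have := A.mul_mem (hA (parityOp n)) (h (Pi.single (Sum.inr i) 1))
      rwa [field_inr_single, ← Matrix.mul_kronecker_mul, parityOp_mul_self, one_mul] at this
    · rw [Matrix.kronecker_smul, Matrix.one_kronecker_one]; exact A.smul_mem A.one_mem c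
    · rw [Matrix.kronecker_add]; exact A.add_mem hM hN
    · have := A.mul_mem hM hN
      rwa [← Matrix.mul_kronecker_mul, one_mul] at this
  rw [eq_top_iff]
  intro M _
  rw [Matrix.matrix_eq_sum_single M]
  refine A.sum_mem fun x _ => A.sum_mem fun y _ => ?_
  have := A.smul_mem (A.mul_mem (hA (Matrix.single x.1 y.1 1)) (hB (Matrix.single x.2 y.2 1))) (M x y)
  rw [← Matrix.mul_kronecker_mul, one_mul, mul_one, Matrix.single_kronecker_single] at this
  simpa using this

lemma exists_eq_smul_one_of_commute_field {M : PairOp n} (h : ∀ f, field f * M = M * field f) :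
    ∃ c : ℂ, M = c • 1 := by
  have : Subalgebra.centralizer ℂ {M} = ⊤ := subalgebra_eq_top_of_field_mem _ fun f => by
    rw [Subalgebra.mem_centralizer_iff]
    rintro _ rfl
    exact (h f).symm
  refine exists_eq_smul_one_of_commute_single fun N => ?_
  have hN : N ∈ Subalgebra.centralizer ℂ {M} := this ▸ trivial
  exact ((Subalgebra.mem_centralizer_iff ℂ).1 hN M rfl).symm

/-- A linear functional is determined by its values on products of fields. -/
lemma eq_of_correlations {ρ ρ' : PairOp n}
    (h : ∀ (k : ℕ) (f : Fin k → GlobalIdx n → ℂ),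
      (ρ * (List.ofFn fun i => field (f i)).prod).trace
        = (ρ' * (List.ofFn fun i => field (f i)).prod).trace) : ρ = ρ' := by
  rw [Matrix.ext_iff_trace_mul_right]
  intro M
  have htop : Algebra.adjoin ℂ (Set.range (field (n := n))) = ⊤ :=
    subalgebra_eq_top_of_field_mem _ fun f => Algebra.subset_adjoin ⟨f, rfl⟩
  have hM : M ∈ Submodule.span ℂ
      (Submonoid.closure (Set.range (field (n := n))) : Set (PairOp n)) := by
    rw [← Algebra.adjoin_eq_span, htop]; trivial
  induction hM using Submodule.span_induction with
  | mem M hM =>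
    obtain ⟨l, hl, rfl⟩ := Submonoid.exists_list_of_mem_closure hM
    choose! g hg using hl
    have : l = List.ofFn fun i : Fin l.length => field (g (l.get i)) := by
      conv_lhs => rw [← List.ofFn_get l]
      congr 1
      ext1 i
      exact (hg _ (List.get_mem l i)).symm
    rw [this]
    exact h _ _
  | zero => simp
  | add M N _ _ hM hN => rw [mul_add, mul_add, Matrix.trace_add, Matrix.trace_add, hM, hN]
  | smul c M _ hM => rw [Matrix.mul_smul, Matrix.mul_smul, Matrix.trace_smul, Matrix.trace_smul, hM]

lemma wickSum_odd {E : Type*} (w : E → E → ℂ) : ∀ (k : ℕ) (f : Fin k → E), Odd k → wickSum w k f = 0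
  | 0, _, h => by simp at h
  | 1, _, _ => rfl
  | k + 2, f, h => by
    have hk : Odd k := by
      rw [Nat.odd_add] at h; exact h.2 even_two
    simp [wickSum, wickSum_odd w k _ hk]

lemma IsQuasifreeWith.unique {S : Matrix (GlobalIdx n) (GlobalIdx n) ℂ} {ρ ρ' : PairOp n}
    (h : IsQuasifreeWith S ρ) (h' : IsQuasifreeWith S ρ') : ρ = ρ' :=
  eq_of_correlations fun k f => by rw [h.wick, h'.wick]

lemma totalParity_mul_prod {k : ℕ} (f : Fin k → GlobalIdx n → ℂ) :
    totalParity n * (List.ofFn fun i => field (f i)).prod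
      = (-1 : ℂ) ^ k • ((List.ofFn fun i => field (f i)).prod * totalParity n) := by
  induction k with
  | zero => simp
  | succ k ih =>
    rw [List.ofFn_succ, List.prod_cons, ← mul_assoc, totalParity_mul_field, neg_mul, mul_assoc,
      ih, mul_smul_comm, pow_succ, mul_assoc]
    simp

/-- The correlation functions of odd order vanish, so a quasifree state is even. -/
lemma IsQuasifreeWith.totalParity_conj {S : Matrix (GlobalIdx n) (GlobalIdx n) ℂ} {ρ : PairOp n}
    (h : IsQuasifreeWith S ρ) : totalParity n * ρ * totalParity n = ρ := by
  refine eq_of_correlations fun k f => ?_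
  rw [mul_assoc, totalParity_mul_prod, Matrix.mul_smul, Matrix.trace_smul, ← mul_assoc,
    Matrix.trace_mul_comm, ← mul_assoc, ← mul_assoc, totalParity_mul_self, one_mul, h.wick]
  rcases Nat.even_or_odd k with hk | hk
  · simp [hk.neg_one_pow]
  · simp [wickSum_odd _ _ _ hk]

/-! ### Bogolubov transformations and their implementation -/

lemma globalConj_single (i : GlobalIdx n) :
    globalConj (Pi.single i 1 : GlobalIdx n → ℂ) = Pi.single (swapIdx i) 1 := by
  ext j
  rw [globalConj_apply]
  by_cases h : swapIdx j = i
  · subst h; simp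
  · have h' : j ≠ swapIdx i := fun e => h (by rw [e]; simp)
    simp [h, h']

/-- Bogolubov transformations of the global one-particle space: unitaries that commute with `Γ`,
not necessarily block diagonal. -/
structure IsBogolubov (V : Matrix (GlobalIdx n) (GlobalIdx n) ℂ) : Prop where
  unitary : V ∈ Matrix.unitaryGroup (GlobalIdx n) ℂ
  conj : ∀ f, globalConj (V *ᵥ f) = V *ᵥ globalConj f

namespace IsBogolubov

variable {V : Matrix (GlobalIdx n) (GlobalIdx n) ℂ}

lemma one : IsBogolubov (1 : Matrix (GlobalIdx n) (GlobalIdx n) ℂ) :=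
  ⟨one_mem _, fun f => by simp⟩

lemma conjTranspose_mul (h : IsBogolubov V) : Vᴴ * V = 1 := Matrix.mem_unitaryGroup_iff'.1 h.unitary

lemma mul_conjTranspose (h : IsBogolubov V) : V * Vᴴ = 1 := Matrix.mem_unitaryGroup_iff.1 h.unitary

lemma conjTranspose (h : IsBogolubov V) : IsBogolubov Vᴴ := by
  refine ⟨Matrix.mem_unitaryGroup_iff.2 ?_, fun f => ?_⟩
  · rw [Matrix.star_eq_conjTranspose, Matrix.conjTranspose_conjTranspose]
    exact h.conjTranspose_mul
  · have e := h.conj (Vᴴ *ᵥ f)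
    rw [Matrix.mulVec_mulVec, h.mul_conjTranspose, Matrix.one_mulVec] at e
    rw [e, Matrix.mulVec_mulVec, h.conjTranspose_mul, Matrix.one_mulVec]

lemma twoPoint_conj (h : IsBogolubov V) (S : Matrix (GlobalIdx n) (GlobalIdx n) ℂ)
    (f g : GlobalIdx n → ℂ) :
    twoPoint (V * S * Vᴴ) f g = twoPoint S (Vᴴ *ᵥ f) (Vᴴ *ᵥ g) := by
  rw [twoPoint, twoPoint, h.conjTranspose.conj, Matrix.star_mulVec,
    Matrix.conjTranspose_conjTranspose, ← Matrix.dotProduct_mulVec, Matrix.mulVec_mulVec,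
    Matrix.mulVec_mulVec, Matrix.mul_assoc]

lemma twoPoint_one (h : IsBogolubov V) (f g : GlobalIdx n → ℂ) :
    twoPoint 1 (V *ᵥ f) (V *ᵥ g) = twoPoint 1 f g := by
  have := h.conjTranspose.twoPoint_conj 1 f g
  rw [Matrix.conjTranspose_conjTranspose, mul_one, h.conjTranspose_mul] at this
  exact this.symm

/-- The label of the annihilation operator of a mode of Alice or Bob. -/
def annIdx : Fin n ⊕ Fin n → GlobalIdx n := Sum.map Sum.inl Sum.inl

lemma isCAR (h : IsBogolubov V) :
    IsCAR fun k : Fin n ⊕ Fin n => field (V *ᵥ Pi.single (annIdx k) 1) := by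
  refine ⟨fun j k => ?_, fun j k => ?_⟩
  · rw [field_anticomm, h.twoPoint_one, twoPoint_single]
    rcases j with j | j <;> rcases k with k | k <;> simp [annIdx, swapIdx, Matrix.one_apply]
  · rw [conjTranspose_field, h.conj, field_anticomm, h.twoPoint_one, globalConj_single,
      twoPoint_single]
    rcases j with j | j <;> rcases k with k | k <;>
      simp [annIdx, swapIdx, Matrix.one_apply]

/-- Every Bogolubov transformation is unitarily implementable. -/
lemma exists_implementer (h : IsBogolubov V) :
    ∃ U ∈ Matrix.unitaryGroup (FockIdx n × FockIdx n) ℂ,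
      ∀ f, Uᴴ * field f * U = field (V *ᵥ f) := by
  have hidx (p : GlobalIdx n → Prop) (h1 : ∀ k : Fin n ⊕ Fin n, p (annIdx k))
      (h2 : ∀ k : Fin n ⊕ Fin n, p (swapIdx (annIdx k))) (i) : p i := by
    rcases i with (j | j) | (j | j)
    · exact h1 (Sum.inl j)
    · exact h2 (Sum.inl j)
    · exact h1 (Sum.inr j)
    · exact h2 (Sum.inr j)
  obtain ⟨W, hW, hWa⟩ := (IsBogolubov.one (n := n)).isCAR.exists_unitary h.isCAR
    (fun M h1 h2 => exists_eq_smul_one_of_commute_field fun f => by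
      rw [field_eq_sum, Finset.sum_mul, Finset.mul_sum]
      refine Finset.sum_congr rfl fun i hi => ?_
      rw [Matrix.smul_mul, Matrix.mul_smul]
      congr 1
      clear hi
      revert i
      refine hidx _ (fun k => ?_) (fun k => ?_)
      · simpa only [Matrix.one_mulVec] using h1 k
      · simpa only [Matrix.one_mulVec, conjTranspose_field, globalConj_single] using h2 k)
    (totalParity n) conjTranspose_totalParity totalParity_mul_self
    (fun k => totalParity_mul_field _)
  have hWf (f : GlobalIdx n → ℂ) : field (V *ᵥ f) * W = W * field f := by
    rw [field_mulVec_eq_sum, field_eq_sum f, Finset.sum_mul, Finset.mul_sum]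
    refine Finset.sum_congr rfl fun i hi => ?_
    rw [Matrix.smul_mul, Matrix.mul_smul]
    congr 1
    clear hi
    revert i
    refine hidx _ (fun k => ?_) (fun k => ?_)
    · simpa only [Matrix.one_mulVec] using (hWa k).1
    · simpa only [Matrix.one_mulVec, conjTranspose_field, globalConj_single, h.conj]
        using (hWa k).2
  refine ⟨Wᴴ, Unitary.star_mem hW, fun f => ?_⟩
  rw [Matrix.conjTranspose_conjTranspose, ← hWf, mul_assoc]
  have : W * Wᴴ = 1 := Matrix.mem_unitaryGroup_iff.1 hW
  rw [this, mul_one]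

end IsBogolubov

/-- The correlation functions of `U† ρ U` are those of `ρ`, with the fields transformed by `V†`. -/
lemma trace_conj_mul_prod {V : Matrix (GlobalIdx n) (GlobalIdx n) ℂ} (hV : IsBogolubov V)
    {U : PairOp n} (hU : U ∈ Matrix.unitaryGroup (FockIdx n × FockIdx n) ℂ)
    (hUV : ∀ f, Uᴴ * field f * U = field (V *ᵥ f)) (ρ : PairOp n) {k : ℕ}
    (f : Fin k → GlobalIdx n → ℂ) :
    (Uᴴ * ρ * U * (List.ofFn fun i => field (f i)).prod).trace
      = (ρ * (List.ofFn fun i => field (Vᴴ *ᵥ f i)).prod).trace := by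
  have hUU : U * Uᴴ = 1 := Matrix.mem_unitaryGroup_iff.1 hU
  have hf (g : GlobalIdx n → ℂ) : U * field g = field (Vᴴ *ᵥ g) * U := by
    have := hUV (Vᴴ *ᵥ g)
    rw [Matrix.mulVec_mulVec, hV.mul_conjTranspose, Matrix.one_mulVec] at this
    rw [← this, ← mul_assoc, ← mul_assoc, hUU, one_mul]
  have hprod : U * (List.ofFn fun i => field (f i)).prod
      = (List.ofFn fun i => field (Vᴴ *ᵥ f i)).prod * U := by
    induction k with
    | zero => simp
    | succ k ih =>
      rw [List.ofFn_succ, List.ofFn_succ, List.prod_cons, List.prod_cons, ← mul_assoc, hf,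
        mul_assoc, ih, mul_assoc]
  rw [mul_assoc, hprod, ← mul_assoc, Matrix.trace_mul_comm, ← mul_assoc, ← mul_assoc, hUU, one_mul]

lemma IsQuasifreeWith.conj {S V : Matrix (GlobalIdx n) (GlobalIdx n) ℂ} {ρ U : PairOp n}
    (h : IsQuasifreeWith S ρ) (hV : IsBogolubov V)
    (hU : U ∈ Matrix.unitaryGroup (FockIdx n × FockIdx n) ℂ)
    (hUV : ∀ f, Uᴴ * field f * U = field (V *ᵥ f)) :
    IsQuasifreeWith (V * S * Vᴴ) (Uᴴ * ρ * U) := by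
  have hUU : U * Uᴴ = 1 := Matrix.mem_unitaryGroup_iff.1 hU
  have htp : twoPoint (V * S * Vᴴ) = fun f g => twoPoint S (Vᴴ *ᵥ f) (Vᴴ *ᵥ g) := by
    ext f g; exact hV.twoPoint_conj S f g
  have hw : ∀ (k : ℕ) (f : Fin k → GlobalIdx n → ℂ),
      wickSum (twoPoint S) k (fun i => Vᴴ *ᵥ f i)
        = wickSum (fun f g => twoPoint S (Vᴴ *ᵥ f) (Vᴴ *ᵥ g)) k f := by
    intro k
    induction k using Nat.strong_induction_on with
    | _ k ih =>
      intro f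
      match k, f with
      | 0, _ => rfl
      | 1, _ => rfl
      | k + 2, f =>
        simp only [wickSum]
        exact Finset.sum_congr rfl fun j _ => by rw [ih k (by omega) fun i => f (j.succAbove i).succ]
  refine ⟨⟨h.isDensity.1.conjTranspose_mul_mul_same U, ?_⟩, fun f g => ?_, fun k f => ?_⟩
  · rw [Matrix.trace_mul_comm, ← mul_assoc, hUU, one_mul, h.isDensity.2]
  · have := trace_conj_mul_prod hV hU hUV ρ ![f, g]
    simp only [List.ofFn_succ, List.ofFn_zero, List.prod_cons, List.prod_nil, mul_one] at this
    rw [hV.twoPoint_conj, ← h.covariance]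
    exact this
  · rw [trace_conj_mul_prod hV hU hUV, h.wick, htp, hw]

/-! ### The standard state -/

/-- The vector `∑ M_{IJ} e_I ⊗ e_J` of `ℋ ⊗ ℋ`. -/
def vecOf (M : FockOp n) : FockIdx n × FockIdx n → ℂ := fun p => M p.1 p.2

lemma kronecker_mulVec_vecOf (A B M : FockOp n) : (A ⊗ₖ B) *ᵥ vecOf M = vecOf (A * M * Bᵀ) := by
  ext ⟨x, y⟩
  simp only [Matrix.mulVec, dotProduct, Fintype.sum_prod_type, vecOf, Matrix.mul_apply,
    Matrix.kroneckerMap_apply, Matrix.transpose_apply, Finset.sum_mul]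
  rw [Finset.sum_comm]
  exact Finset.sum_congr rfl fun _ _ => Finset.sum_congr rfl fun _ _ => by ring

lemma traceRight_vecOf (M : FockOp n) :
    traceRight (Matrix.vecMulVec (vecOf M) (star (vecOf M))) = M * Mᴴ := by
  ext x x'
  simp [traceRight, Matrix.vecMulVec_apply, vecOf, Matrix.mul_apply]

lemma traceLeft_vecOf (M : FockOp n) :
    traceLeft (Matrix.vecMulVec (vecOf M) (star (vecOf M))) = (Mᴴ * M)ᵀ := by
  ext x x'
  simp [traceLeft, Matrix.vecMulVec_apply, vecOf, Matrix.mul_apply, mul_comm]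

/-- Wick's theorem for a state `ρ` such that every `f` splits as `p f + q f` with `ρ B(p f) = 0` and
`B(q f) ρ = 0`: the first field of a product may be replaced by its part `B(q f)`, which vanishes
after being moved to the other end. -/
lemma isQuasifreeWith_of_split {S : Matrix (GlobalIdx n) (GlobalIdx n) ℂ} {ρ : PairOp n}
    (hρ : IsDensity ρ) (p q : (GlobalIdx n → ℂ) → GlobalIdx n → ℂ) (hpq : ∀ f, p f + q f = f)
    (hp : ∀ f, ρ * field (p f) = 0) (hq : ∀ f, field (q f) * ρ = 0)
    (hS : ∀ f g, twoPoint 1 (q f) g = twoPoint S f g) : IsQuasifreeWith S ρ := by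
  have hwick : ∀ (k : ℕ) (f : Fin k → GlobalIdx n → ℂ),
      (ρ * (List.ofFn fun i => field (f i)).prod).trace = wickSum (twoPoint S) k f := by
    have hsplit (f : GlobalIdx n → ℂ) (M : PairOp n) :
        ρ * (field f * M) = ρ * (field (q f) * M) := by
      conv_lhs => rw [← hpq f, field_add, add_mul, mul_add, ← mul_assoc, hp, zero_mul, zero_add]
    have hq' (f : GlobalIdx n → ℂ) (M : PairOp n) : (ρ * (M * field (q f))).trace = 0 := by
      rw [← mul_assoc, Matrix.trace_mul_comm, ← mul_assoc, hq, zero_mul, Matrix.trace_zero]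
    intro k
    induction k using Nat.strong_induction_on with
    | _ k ih =>
      intro f
      match k, f with
      | 0, _ => simpa [wickSum] using hρ.2
      | 1, f =>
        have := hq' (f 0) 1
        rw [one_mul] at this
        rw [List.ofFn_succ, List.ofFn_zero, List.prod_cons, hsplit, List.prod_nil, mul_one, this]
        rfl
      | k + 2, f =>
        rw [List.ofFn_succ, List.prod_cons, hsplit,
          mul_prod_ofFn_of_anticomm (field (q (f 0))) (fun i : Fin (k + 1) => field (f i.succ))
            (fun i => twoPoint S (f 0) (f i.succ)) (fun j => by rw [field_anticomm, hS]),
          mul_add, Matrix.trace_add, Matrix.mul_smul, Matrix.trace_smul, hq', smul_zero, add_zero,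
          Finset.mul_sum, Matrix.trace_sum, wickSum]
        refine Finset.sum_congr rfl fun j _ => ?_
        rw [Matrix.mul_smul, Matrix.trace_smul, smul_eq_mul,
          ih k (by omega) fun i => f (j.succAbove i).succ]
  refine ⟨hρ, fun f g => ?_, hwick⟩
  have := hwick 2 ![f, g]
  simp only [List.ofFn_succ, List.ofFn_zero, List.prod_cons, List.prod_nil, mul_one] at this
  simpa [wickSum] using this

lemma IsPure.isDensity {X : Type*} [Fintype X] {ρ : Matrix X X ℂ} (h : IsPure ρ) : IsDensity ρ := by
  obtain ⟨ψ, h1, rfl⟩ := h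
  refine ⟨Matrix.posSemidef_vecMulVec_self_star ψ, ?_⟩
  rw [Matrix.trace_vecMulVec, dotProduct_comm, h1]

/-- The operator `Ψ` on Fock space that yields the standard state. It exists because both `iθ cⱼ` and
the transposed operators `cⱼᵀ` satisfy the canonical anticommutation relations. -/
lemma exists_unitary_mul_transpose_ladder :
    ∃ Ψ ∈ Matrix.unitaryGroup (FockIdx n) ℂ,
      ∀ i, (Complex.I • (parityOp n * ladder i)) * Ψ = Ψ * (ladder i)ᵀ := by
  have hs (i : LocalIdx n) : (Complex.I • (parityOp n * ladder i))ᴴ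
      = Complex.I • (parityOp n * ladder i.swap) := by
    rw [Matrix.conjTranspose_smul, Matrix.conjTranspose_mul, conjTranspose_ladder,
      conjTranspose_parityOp, parityOp_mul_ladder]
    simp
  have hanti (i k : LocalIdx n) : (Complex.I • (parityOp n * ladder i))
        * (Complex.I • (parityOp n * ladder k)) = ladder i * ladder k := by
    rw [Matrix.smul_mul, Matrix.mul_smul, smul_smul, Complex.I_mul_I, mul_assoc, ← mul_assoc (ladder i),
      ← neg_eq_iff_eq_neg.2 (parityOp_mul_ladder i), neg_mul, mul_neg, mul_assoc, ← mul_assoc,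
      parityOp_mul_self]
    simp
  have hcar : IsCAR fun j : Fin n => (ladder (Sum.inl j))ᵀ := by
    refine ⟨fun j k => ?_, fun j k => ?_⟩
    · rw [transpose_ladder, transpose_ladder, ladder_anticomm]; simp
    · rw [transpose_ladder, transpose_ladder, conjTranspose_ladder, ladder_anticomm]; simp
  have hcar' : IsCAR fun j : Fin n => Complex.I • (parityOp n * ladder (Sum.inl j)) := by
    refine ⟨fun j k => ?_, fun j k => ?_⟩
    · rw [hanti, hanti, ladder_anticomm]; simp
    · rw [hs, hanti, hanti, ladder_anticomm]; simp
  obtain ⟨Ψ, hΨ, h⟩ := hcar.exists_unitary hcar'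
    (fun M h1 h2 => by
      have hl (i : LocalIdx n) : Commute (ladder i) M := by
        rcases i with j | j
        · have := h2 j
          rwa [transpose_ladder, conjTranspose_ladder] at this
        · have := h1 j
          rwa [transpose_ladder] at this
      exact exists_eq_smul_one_of_commute_single fun N => fockOp_induction (p := fun N => Commute N M)
        hl (fun c => (Commute.one_left M).smul_left c) (fun _ _ => Commute.add_left)
        (fun _ _ => Commute.mul_left) N)
    (parityOp n) conjTranspose_parityOp parityOp_mul_self
    (fun j => by
      rw [Matrix.mul_smul, Matrix.smul_mul, ← mul_assoc, parityOp_mul_self,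
        parityOp_mul_ladder, neg_mul, mul_assoc, parityOp_mul_self]
      simp)
  refine ⟨Ψ, hΨ, fun i => ?_⟩
  rcases i with j | j
  · exact (h j).1
  · have := (h j).2
    rw [hs, transpose_ladder, conjTranspose_ladder] at this
    rw [transpose_ladder]
    exact this

/-- The action of the projection `P_st` on the one-particle space. -/
lemma standardCov_mulVec (f : GlobalIdx n → ℂ) :
    standardCov n *ᵥ f = Sum.elim
      (fun i => (1 / 2 : ℂ) * (f (Sum.inl i) + Complex.I * f (Sum.inr i)))
      (fun i => (1 / 2 : ℂ) * (f (Sum.inr i) - Complex.I * f (Sum.inl i))) := by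
  rw [standardCov, Matrix.smul_mulVec, Matrix.fromBlocks_mulVec]
  ext i
  rcases i with i | i <;>
    simp [Matrix.smul_mulVec, Matrix.neg_mulVec, Function.comp_def]
  ring

/-- The standard state is the vector state of the normalized operator `Ψ`. Its reduction to Alice's
system is `2⁻ⁿ Ψ Ψ† = 2⁻ⁿ`. -/
lemma exists_standardState (n : ℕ) :
    ∃ ρ : PairOp n, IsQuasifreeWith (standardCov n) ρ ∧ IsPure ρ ∧
      traceRight ρ = (2 ^ n : ℂ)⁻¹ • 1 := by
  obtain ⟨Ψ, hΨ, hl⟩ := exists_unitary_mul_transpose_ladder (n := n)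
  have hΨΨ : Ψ * Ψᴴ = 1 := Matrix.mem_unitaryGroup_iff.1 hΨ
  have hf (f : LocalIdx n → ℂ) :
      localField f * Ψ + Complex.I • (parityOp n * Ψ * (localField f)ᵀ) = 0 := by
    have : Ψ * (localField f)ᵀ = Complex.I • (parityOp n * localField f * Ψ) := by
      simp only [localField, Matrix.transpose_sum, Matrix.transpose_smul, Finset.mul_sum,
        Matrix.mul_smul, ← hl, Finset.sum_mul, Matrix.smul_mul, Finset.smul_sum]
      exact Finset.sum_congr rfl fun i _ => smul_comm _ _ _
    rw [mul_assoc, this, Matrix.mul_smul, smul_smul, Complex.I_mul_I, ← mul_assoc, ← mul_assoc,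
      parityOp_mul_self, one_mul]
    simp
  set c : ℂ := (((Real.sqrt (2 ^ n))⁻¹ : ℝ) : ℂ) with hc
  have hcc : c * c = (2 ^ n : ℂ)⁻¹ := by
    rw [hc, ← Complex.ofReal_mul, ← mul_inv, Real.mul_self_sqrt (by positivity)]
    push_cast; rfl
  have hcs : star c = c := by rw [hc]; exact Complex.conj_ofReal _
  set M : FockOp n := c • Ψ with hM
  have hMM : M * Mᴴ = (2 ^ n : ℂ)⁻¹ • 1 := by
    rw [hM, Matrix.conjTranspose_smul, Matrix.smul_mul, Matrix.mul_smul, hΨΨ, smul_smul, hcs, hcc]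
  set ρ : PairOp n := Matrix.vecMulVec (vecOf M) (star (vecOf M)) with hρ
  have htr : traceRight ρ = (2 ^ n : ℂ)⁻¹ • 1 := by rw [hρ, traceRight_vecOf, hMM]
  have hpure : IsPure ρ := by
    refine ⟨vecOf M, ?_, rfl⟩
    have h1 : ρ.trace = (traceRight ρ).trace := by
      simp [Matrix.trace, traceRight, Fintype.sum_prod_type]
    rw [dotProduct_comm, ← Matrix.trace_vecMulVec, ← hρ, h1, htr]
    simp
  -- the vectors `(v, iv)` form the kernel of `P_st`
  have hann (v : LocalIdx n → ℂ) : field (Sum.elim v fun i => Complex.I * v i) * ρ = 0 := by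
    have h1 : localField (fun i => Complex.I * v i) = Complex.I • localField v := by
      simp [localField, Finset.smul_sum, mul_smul]
    have h2 : field (Sum.elim v fun i => Complex.I * v i) *ᵥ vecOf M = 0 := by
      rw [field_eq, Matrix.add_mulVec, kronecker_mulVec_vecOf, kronecker_mulVec_vecOf]
      simp only [Sum.elim_inl, Sum.elim_inr, h1, Matrix.transpose_one, mul_one]
      change vecOf (localField v * M + parityOp n * M * (Complex.I • localField v)ᵀ) = 0
      have : localField v * M + parityOp n * M * (Complex.I • localField v)ᵀ
          = c • (localField v * Ψ + Complex.I • (parityOp n * Ψ * (localField v)ᵀ)) := by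
        rw [hM, Matrix.transpose_smul]
        simp only [Matrix.mul_smul, Matrix.smul_mul, smul_add]
        rw [smul_comm]
      rw [this, hf, smul_zero]; rfl
    rw [hρ, Matrix.mul_vecMulVec, h2, Matrix.zero_vecMulVec]
  have hρs : ρᴴ = ρ := hpure.isDensity.1.1
  refine ⟨ρ, ?_, hpure, htr⟩
  refine isQuasifreeWith_of_split hpure.isDensity (fun f => standardCov n *ᵥ f)
    (fun f => f - standardCov n *ᵥ f) (fun f => by simp) (fun f => ?_) (fun f => ?_)
    (fun f g => ?_)
  · have h1 : globalConj (standardCov n *ᵥ f) = Sum.elim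
        (fun i => globalConj (standardCov n *ᵥ f) (Sum.inl i))
        (fun i => Complex.I * globalConj (standardCov n *ᵥ f) (Sum.inl i)) := by
      ext i
      rcases i with i | i
      · rfl
      · simp only [globalConj_apply, standardCov_mulVec, swapIdx, Sum.map_inl, Sum.map_inr,
          Sum.elim_inl, Sum.elim_inr]
        simp
        linear_combination (1 / 2 * starRingEnd ℂ (f (Sum.inr i.swap))) * Complex.I_mul_I
    have h2 := hann (fun i => globalConj (standardCov n *ᵥ f) (Sum.inl i))
    rw [← h1, ← conjTranspose_field] at h2
    have h3 := congrArg Matrix.conjTranspose h2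
    rwa [Matrix.conjTranspose_mul, Matrix.conjTranspose_conjTranspose, hρs,
      Matrix.conjTranspose_zero] at h3
  · have h1 : f - standardCov n *ᵥ f = Sum.elim
        (fun i => (f - standardCov n *ᵥ f) (Sum.inl i))
        (fun i => Complex.I * (f - standardCov n *ᵥ f) (Sum.inl i)) := by
      ext i
      rcases i with i | i
      · rfl
      · simp only [Pi.sub_apply, standardCov_mulVec, Sum.elim_inl, Sum.elim_inr]
        linear_combination (1 / 2 * f (Sum.inr i)) * Complex.I_mul_I
    rw [h1]
    exact hann _
  · have hsum (F : GlobalIdx n → ℂ) : ∑ i, F i = ∑ i, F (Sum.inl i) + ∑ i, F (Sum.inr i) :=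
      Fintype.sum_sum_type F
    rw [twoPoint_eq, twoPoint_eq, standardCov_mulVec, standardCov_mulVec, Matrix.one_mulVec,
      dotProduct, dotProduct, hsum, hsum]
    simp only [swapIdx, Sum.map_inl, Sum.map_inr, Pi.sub_apply, Sum.elim_inl, Sum.elim_inr]
    rw [← Finset.sum_add_distrib, ← Finset.sum_add_distrib]
    exact Finset.sum_congr rfl fun i _ => by ring

/-! ### Maximal entanglement of even pure states -/

lemma trace_traceRight {X Y : Type*} [Fintype X] [Fintype Y] (σ : Matrix (X × Y) (X × Y) ℂ) :
    (traceRight σ).trace = σ.trace := by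
  simp [Matrix.trace, traceRight, Fintype.sum_prod_type]

lemma trace_traceLeft {X Y : Type*} [Fintype X] [Fintype Y] (σ : Matrix (X × Y) (X × Y) ℂ) :
    (traceLeft σ).trace = σ.trace := by
  simp only [Matrix.trace, traceLeft, Fintype.sum_prod_type, Matrix.diag_apply, Matrix.of_apply]
  exact Finset.sum_comm

/-- Normalization of a rank one operator gives a pure state. -/
lemma isPure_inv_trace_smul {X : Type*} [Fintype X] (φ : X → ℂ)
    (h : (Matrix.vecMulVec φ (star φ)).trace ≠ 0) :
    IsPure ((Matrix.vecMulVec φ (star φ)).trace⁻¹ • Matrix.vecMulVec φ (star φ)) := by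
  set r : ℝ := ∑ x, ‖φ x‖ ^ 2 with hr
  have ht : (Matrix.vecMulVec φ (star φ)).trace = (r : ℂ) := by
    rw [Matrix.trace_vecMulVec, dotProduct, hr]
    push_cast
    exact Finset.sum_congr rfl fun x _ => Complex.mul_conj' (φ x)
  rw [ht] at h ⊢
  have hr0 : 0 ≤ r := Finset.sum_nonneg fun _ _ => by positivity
  have hcc : (((Real.sqrt r)⁻¹ : ℝ) : ℂ) * (((Real.sqrt r)⁻¹ : ℝ) : ℂ) = (r : ℂ)⁻¹ := by
    rw [← Complex.ofReal_mul, ← mul_inv, Real.mul_self_sqrt hr0, Complex.ofReal_inv]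
  have hcs : star (((Real.sqrt r)⁻¹ : ℝ) : ℂ) = (((Real.sqrt r)⁻¹ : ℝ) : ℂ) := Complex.conj_ofReal _
  refine ⟨(((Real.sqrt r)⁻¹ : ℝ) : ℂ) • φ, ?_, ?_⟩
  · rw [star_smul, hcs, smul_dotProduct, dotProduct_smul, smul_smul, hcc, dotProduct_comm,
      ← Matrix.trace_vecMulVec, ht, smul_eq_mul, inv_mul_cancel₀ h]
  · rw [star_smul, hcs, Matrix.smul_vecMulVec, Matrix.vecMulVec_smul, smul_smul, hcc]

/-- An even state has no matrix elements between vectors of different total parity. -/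
lemma parity_eq_of_apply_ne_zero {ρ : PairOp n} (h : totalParity n * ρ * totalParity n = ρ)
    {x y x' y' : FockIdx n} (h0 : ρ (x, y) (x', y') ≠ 0) :
    (x.card : ZMod 2) + y.card = x'.card + y'.card := by
  have hd : totalParity n = Matrix.diagonal fun p => (-1 : ℂ) ^ (p.1.card + p.2.card) := by
    simp only [totalParity, parityOp, Matrix.diagonal_kronecker_diagonal, pow_add]
  have e := congrFun (congrFun h (x, y)) (x', y')
  rw [hd, Matrix.mul_diagonal, Matrix.diagonal_mul] at e
  by_contra hne
  have hpar : ¬ (Even (x.card + y.card) ↔ Even (x'.card + y'.card)) := by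
    intro hh
    apply hne
    have : (((x.card + y.card : ℕ)) : ZMod 2) = ((x'.card + y'.card : ℕ) : ZMod 2) := by
      rw [ZMod.natCast_eq_natCast_iff', ← Nat.ModEq, Nat.ModEq]
      rw [Nat.even_iff, Nat.even_iff] at hh
      omega
    exact_mod_cast this
  apply h0
  rcases Nat.even_or_odd (x.card + y.card) with h1 | h1 <;>
    rcases Nat.even_or_odd (x'.card + y'.card) with h2 | h2
  · exact absurd (iff_of_true h1 h2) hpar
  · rw [h1.neg_one_pow, h2.neg_one_pow] at e
    linear_combination (-1 / 2 : ℂ) * e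
  · rw [h1.neg_one_pow, h2.neg_one_pow] at e
    linear_combination (-1 / 2 : ℂ) * e
  · exact absurd (iff_of_false (Nat.not_even_iff_odd.2 h1) (Nat.not_even_iff_odd.2 h2)) hpar

lemma sum_sector (b : ZMod 2) (F : FockIdx n → ℂ)
    (hF : ∀ y : FockIdx n, F y ≠ 0 → (y.card : ZMod 2) = b) :
    ∑ y : Sector n b, F y.1 = ∑ y, F y := by
  rw [← Finset.sum_subtype (Finset.univ.filter fun y : FockIdx n => (y.card : ZMod 2) = b)
    (by simp) F]
  exact Finset.sum_filter_of_ne fun y _ hy => hF y hy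

/-- An even pure state with totally mixed reduction to Alice's system is maximally entangled: by
purity Bob's reduction is totally mixed too, and by evenness a parity of Alice fixes the one
of Bob, so that the reductions of a block are restrictions of the full reductions. -/
lemma isMaxEntangled_of_traceRight {ρ : PairOp n} (hp : IsPure ρ)
    (hΘ : totalParity n * ρ * totalParity n = ρ) (hR : traceRight ρ = (2 ^ n : ℂ)⁻¹ • 1) :
    IsMaxEntangled ρ := by
  refine ⟨hp, fun a b ht => ?_⟩
  obtain ⟨ψ, -, hψ⟩ := hp
  set κ : ℂ := (2 ^ n : ℂ)⁻¹ with hκ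
  have hκ0 : κ ≠ 0 := by rw [hκ]; positivity
  have hL : traceLeft ρ = κ • 1 := by
    set M : FockOp n := Matrix.of fun x y => ψ (x, y) with hM
    have hv : ψ = vecOf M := rfl
    rw [hψ, hv, traceRight_vecOf] at hR
    have h1 : (κ⁻¹ • M) * Mᴴ = 1 := by
      rw [Matrix.smul_mul, hR, smul_smul, inv_mul_cancel₀ hκ0, one_smul]
    have h2 := mul_eq_one_comm.1 h1
    rw [hψ, hv, traceLeft_vecOf]
    have h3 : Mᴴ * M = κ • 1 := by
      rw [← h2, Matrix.mul_smul, smul_smul, mul_inv_cancel₀ hκ0, one_smul]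
    rw [h3, Matrix.transpose_smul, Matrix.transpose_one]
  have hρ (p q) : ρ p q = ψ p * star (ψ q) := by rw [hψ]; rfl
  set β := parityBlock ρ a b with hβ
  obtain ⟨⟨x₀, y₀⟩, -, h0⟩ := Finset.exists_ne_zero_of_sum_ne_zero ht
  have h0 : ψ (x₀.1, y₀.1) ≠ 0 := fun h => h0 (by
    change ρ (x₀.1, y₀.1) (x₀.1, y₀.1) = 0
    rw [hρ, h, zero_mul])
  have hsupp {x y : FockIdx n} (h : ψ (x, y) ≠ 0) : (x.card : ZMod 2) + y.card = a + b := by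
    have : ρ (x, y) (x₀.1, y₀.1) ≠ 0 := by
      rw [hρ]; exact mul_ne_zero h (star_ne_zero.2 h0)
    rw [parity_eq_of_apply_ne_zero hΘ this, x₀.2, y₀.2]
  have hβR : traceRight β = κ • 1 := by
    ext x x'
    have := congrFun (congrFun hR x.1) x'.1
    have e : (1 : Matrix (Sector n a) (Sector n a) ℂ) x x' = (1 : FockOp n) x.1 x'.1 := by
      simp only [Matrix.one_apply, Subtype.ext_iff]
    rw [Matrix.smul_apply] at this ⊢
    rw [e, ← this]
    refine sum_sector b (fun y => ρ (x.1, y) (x'.1, y)) fun y hy => ?_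
    have := hsupp (x := x.1) (y := y) fun h => hy (by rw [hρ, h, zero_mul])
    rw [x.2] at this
    exact add_left_cancel this
  have hβL : traceLeft β = κ • 1 := by
    ext y y'
    have := congrFun (congrFun hL y.1) y'.1
    have e : (1 : Matrix (Sector n b) (Sector n b) ℂ) y y' = (1 : FockOp n) y.1 y'.1 := by
      simp only [Matrix.one_apply, Subtype.ext_iff]
    rw [Matrix.smul_apply] at this ⊢
    rw [e, ← this]
    refine sum_sector a (fun x => ρ (x, y.1) (x, y'.1)) fun x hx => ?_
    have := hsupp (x := x) (y := y.1) fun h => hx (by rw [hρ, h, zero_mul])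
    rw [y.2] at this
    exact add_right_cancel this
  have hcR : β.trace⁻¹ * κ = (Fintype.card (Sector n a) : ℂ)⁻¹ := by
    apply eq_inv_of_mul_eq_one_left
    have := trace_traceRight β
    rw [hβR, Matrix.trace_smul, Matrix.trace_one, smul_eq_mul] at this
    rw [mul_assoc, this, inv_mul_cancel₀ ht]
  have hcL : β.trace⁻¹ * κ = (Fintype.card (Sector n b) : ℂ)⁻¹ := by
    apply eq_inv_of_mul_eq_one_left
    have := trace_traceLeft β
    rw [hβL, Matrix.trace_smul, Matrix.trace_one, smul_eq_mul] at this
    rw [mul_assoc, this, inv_mul_cancel₀ ht]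
  have hβψ : β = Matrix.vecMulVec (fun p : Sector n a × Sector n b => ψ (p.1.1, p.2.1))
      (star fun p : Sector n a × Sector n b => ψ (p.1.1, p.2.1)) := by
    ext p q
    exact hρ _ _
  refine ⟨?_, ?_, ?_⟩
  · rw [hβψ] at ht ⊢
    exact isPure_inv_trace_smul _ ht
  · have : traceRight (β.trace⁻¹ • β) = β.trace⁻¹ • traceRight β := by
      ext x x'; simp [traceRight, Finset.mul_sum]
    rw [this, hβR, smul_smul, hcR]
  · have : traceLeft (β.trace⁻¹ • β) = β.trace⁻¹ • traceLeft β := by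
      ext x x'; simp [traceLeft, Finset.mul_sum]
    rw [this, hβL, smul_smul, hcL]

lemma IsLocalBogolubov.blockDiag {VA VB : Matrix (LocalIdx n) (LocalIdx n) ℂ}
    (hA : IsLocalBogolubov VA) (hB : IsLocalBogolubov VB) : IsBogolubov (blockDiag VA VB) := by
  refine ⟨Matrix.mem_unitaryGroup_iff.2 ?_, fun f => ?_⟩
  · have h1 : VA * VAᴴ = 1 := Matrix.mem_unitaryGroup_iff.1 hA.1
    have h2 : VB * VBᴴ = 1 := Matrix.mem_unitaryGroup_iff.1 hB.1
    rw [Matrix.star_eq_conjTranspose, FermionPair.blockDiag, Matrix.fromBlocks_conjTranspose,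
      Matrix.fromBlocks_multiply]
    simp [h1, h2]
  · have h1 := hA.2 fun i => f (Sum.inl i)
    have h2 := hB.2 fun i => f (Sum.inr i)
    rw [FermionPair.blockDiag, Matrix.fromBlocks_mulVec, Matrix.fromBlocks_mulVec]
    ext i
    rcases i with i | i
    · simpa [globalConj, Function.comp_def] using congrFun h1 i
    · simpa [globalConj, Function.comp_def] using congrFun h2 i

/-- Local Bogolubov transformations preserve total mixedness of Alice's reduction. -/
lemma traceRight_conj {VA VB : Matrix (LocalIdx n) (LocalIdx n) ℂ}
    (hV : IsBogolubov (blockDiag VA VB)) {U : PairOp n}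
    (hU : U ∈ Matrix.unitaryGroup (FockIdx n × FockIdx n) ℂ)
    (hUV : ∀ f, Uᴴ * field f * U = field (blockDiag VA VB *ᵥ f)) {ρ : PairOp n} {κ : ℂ}
    (hR : traceRight ρ = κ • 1) : traceRight (Uᴴ * ρ * U) = κ • 1 := by
  have hUU : U * Uᴴ = 1 := Matrix.mem_unitaryGroup_iff.1 hU
  have hUU' : Uᴴ * U = 1 := Matrix.mem_unitaryGroup_iff'.1 hU
  -- conjugation by `U` maps Alice's algebra to itself
  have hX (X : FockOp n) :
      ∃ X' : FockOp n, U * (X ⊗ₖ (1 : FockOp n)) * Uᴴ = X' ⊗ₖ (1 : FockOp n) := by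
    refine fockOp_induction (p := fun X => ∃ X' : FockOp n,
      U * (X ⊗ₖ (1 : FockOp n)) * Uᴴ = X' ⊗ₖ (1 : FockOp n)) (fun i => ?_) (fun c => ?_) ?_ ?_ X
    · have h1 := hUV ((blockDiag VA VB)ᴴ *ᵥ Pi.single (Sum.inl i) 1)
      rw [Matrix.mulVec_mulVec, hV.mul_conjTranspose, Matrix.one_mulVec] at h1
      refine ⟨localField fun k => ((blockDiag VA VB)ᴴ *ᵥ Pi.single (Sum.inl i) 1) (Sum.inl k), ?_⟩
      have h2 : localField (fun k =>
          ((blockDiag VA VB)ᴴ *ᵥ Pi.single (Sum.inl i) 1) (Sum.inr k)) = 0 := by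
        simp [localField, blockDiag]
      rw [← field_inl_single, ← h1, ← mul_assoc, ← mul_assoc, hUU, one_mul, mul_assoc, hUU,
        mul_one, field_eq, h2, Matrix.kronecker_zero, add_zero]
    · exact ⟨c • 1, by simp [Matrix.smul_kronecker, hUU]⟩
    · rintro X Y ⟨X', hX⟩ ⟨Y', hY⟩
      exact ⟨X' + Y', by rw [Matrix.add_kronecker, mul_add, add_mul, hX, hY, Matrix.add_kronecker]⟩
    · rintro X Y ⟨X', hX⟩ ⟨Y', hY⟩
      refine ⟨X' * Y', ?_⟩
      have e (A B : FockOp n) :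
          (A * B) ⊗ₖ (1 : FockOp n) = (A ⊗ₖ (1 : FockOp n)) * (B ⊗ₖ (1 : FockOp n)) := by
        rw [← Matrix.mul_kronecker_mul, one_mul]
      rw [e, e, ← hX, ← hY]
      simp only [mul_assoc]
      rw [← mul_assoc Uᴴ U, hUU', one_mul]
  rw [Matrix.ext_iff_trace_mul_right]
  intro X
  obtain ⟨X', hX'⟩ := hX X
  have htr : X'.trace = X.trace := by
    have h1 := congrArg Matrix.trace hX'
    rw [Matrix.trace_mul_comm, ← mul_assoc, hUU', one_mul, Matrix.trace_kronecker,
      Matrix.trace_kronecker, Matrix.trace_one] at h1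
    exact (mul_right_cancel₀ (by simp) h1).symm
  have e : ρ * U * (X ⊗ₖ (1 : FockOp n)) * Uᴴ = ρ * (U * (X ⊗ₖ (1 : FockOp n)) * Uᴴ) := by
    simp only [mul_assoc]
  rw [← trace_mul_kronecker_one, mul_assoc, mul_assoc, Matrix.trace_mul_comm, ← mul_assoc, e, hX',
    trace_mul_kronecker_one, hR]
  simp [htr]

/-! ### Covariances of pure quasifree states -/

lemma IsPure.mul_mul_self {X : Type*} [Fintype X] {ρ : Matrix X X ℂ} (h : IsPure ρ)
    (M : Matrix X X ℂ) : ρ * M * ρ = (ρ * M).trace • ρ := by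
  obtain ⟨ψ, -, rfl⟩ := h
  rw [Matrix.vecMulVec_mul, Matrix.vecMulVec_mul_vecMulVec, Matrix.trace_vecMulVec,
    Matrix.vecMulVec_smul, dotProduct_comm ψ]

lemma IsPure.conj {X : Type*} [Fintype X] [DecidableEq X] {ρ U : Matrix X X ℂ} (h : IsPure ρ)
    (hU : U ∈ Matrix.unitaryGroup X ℂ) : IsPure (Uᴴ * ρ * U) := by
  have hUU : U * Uᴴ = 1 := Matrix.mem_unitaryGroup_iff.1 hU
  obtain ⟨ψ, h1, rfl⟩ := h
  refine ⟨Uᴴ *ᵥ ψ, ?_, ?_⟩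
  · rw [Matrix.star_mulVec, Matrix.conjTranspose_conjTranspose, ← Matrix.dotProduct_mulVec,
      Matrix.mulVec_mulVec, hUU, Matrix.one_mulVec, h1]
  · rw [Matrix.mul_vecMulVec, Matrix.vecMulVec_mul, Matrix.star_mulVec,
      Matrix.conjTranspose_conjTranspose]

lemma twoPoint_mulVec (S T : Matrix (GlobalIdx n) (GlobalIdx n) ℂ) (f g : GlobalIdx n → ℂ) :
    twoPoint S f (T *ᵥ g) = twoPoint (S * T) f g := by
  rw [twoPoint, twoPoint, Matrix.mulVec_mulVec]

lemma twoPoint_sub_left (S : Matrix (GlobalIdx n) (GlobalIdx n) ℂ) (f f' g : GlobalIdx n → ℂ) :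
    twoPoint S (f - f') g = twoPoint S f g - twoPoint S f' g := by
  simp only [twoPoint_eq, dotProduct, Pi.sub_apply, sub_mul, Finset.sum_sub_distrib]

lemma twoPoint_sub (S T : Matrix (GlobalIdx n) (GlobalIdx n) ℂ) (f g : GlobalIdx n → ℂ) :
    twoPoint (S - T) f g = twoPoint S f g - twoPoint T f g := by
  simp only [twoPoint, Matrix.sub_mulVec, dotProduct_sub]

namespace IsQuasifreeWith

variable {S : Matrix (GlobalIdx n) (GlobalIdx n) ℂ} {ρ : PairOp n}

lemma twoPoint_add_twoPoint (h : IsQuasifreeWith S ρ) (f g : GlobalIdx n → ℂ) :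
    twoPoint S f g + twoPoint S g f = twoPoint 1 f g := by
  rw [← h.covariance, ← h.covariance, ← Matrix.trace_add, ← mul_add, field_anticomm,
    Matrix.mul_smul, mul_one, Matrix.trace_smul, h.isDensity.2, smul_eq_mul, mul_one]

lemma apply_eq (h : IsQuasifreeWith S ρ) (i k : GlobalIdx n) :
    S i k = (ρ * (field (Pi.single (swapIdx i) 1) * field (Pi.single k 1))).trace := by
  rw [h.covariance, twoPoint_single, swapIdx_swapIdx]

lemma apply_add_apply (h : IsQuasifreeWith S ρ) (i k : GlobalIdx n) :
    S i k + S (swapIdx k) (swapIdx i) = (1 : Matrix (GlobalIdx n) (GlobalIdx n) ℂ) i k := by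
  have := h.twoPoint_add_twoPoint (Pi.single (swapIdx i) 1) (Pi.single k 1)
  rwa [twoPoint_single, twoPoint_single, twoPoint_single, swapIdx_swapIdx] at this

lemma star_apply (h : IsQuasifreeWith S ρ) (i k : GlobalIdx n) : star (S i k) = S k i := by
  have hρ : ρᴴ = ρ := h.isDensity.1.1
  rw [h.apply_eq, h.apply_eq, ← Matrix.trace_conjTranspose, Matrix.conjTranspose_mul,
    Matrix.conjTranspose_mul, conjTranspose_field, conjTranspose_field, globalConj_single,
    globalConj_single, swapIdx_swapIdx, hρ, Matrix.trace_mul_comm]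

/-- Expansion of a correlation function along its first field. -/
lemma trace_field_mul_prod (h : IsQuasifreeWith S ρ) (u : GlobalIdx n → ℂ) {m : ℕ}
    (g : Fin (m + 1) → GlobalIdx n → ℂ) :
    (ρ * (field u * (List.ofFn fun i => field (g i)).prod)).trace
      = ∑ j : Fin (m + 1), (-1) ^ (j : ℕ) * twoPoint S u (g j) *
          (ρ * (List.ofFn fun i => field (g (j.succAbove i))).prod).trace := by
  have := h.wick (m + 2) (Fin.cons u g)
  rw [List.ofFn_succ, List.prod_cons] at this
  simp only [Fin.cons_zero, Fin.cons_succ] at this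
  rw [this, wickSum]
  refine Finset.sum_congr rfl fun j _ => ?_
  rw [h.wick m fun i => g (j.succAbove i)]
  simp only [Fin.cons_zero, Fin.cons_succ]

lemma trace_field (h : IsQuasifreeWith S ρ) (u : GlobalIdx n → ℂ) : (ρ * field u).trace = 0 := by
  have := h.wick 1 fun _ => u
  rw [List.ofFn_succ, List.ofFn_zero, List.prod_cons, List.prod_nil, mul_one] at this
  exact this

/-- The exchange relation of a quasifree state, a form of the KMS condition that makes sense for all
covariances: expand along a field at the front of a product, and along one at its end. -/
lemma mul_field (h : IsQuasifreeWith S ρ) (f : GlobalIdx n → ℂ) :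
    ρ * field (S *ᵥ f) = field (f - S *ᵥ f) * ρ := by
  set v := f - S *ᵥ f with hv
  have hsymm (a g : GlobalIdx n → ℂ) : twoPoint 1 (S *ᵥ a) g = twoPoint (1 - S) a g := by
    have h1 : twoPoint 1 (S *ᵥ a) g = twoPoint S g a := by
      have := h.twoPoint_add_twoPoint (S *ᵥ a) g
      have h2 := h.twoPoint_add_twoPoint g (S *ᵥ a)
      rw [twoPoint_mulVec 1, one_mul] at h2
      rw [← this, ← h2, add_comm]
    rw [h1, twoPoint_sub, ← h.twoPoint_add_twoPoint a g]; ring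
  have hkey (g : GlobalIdx n → ℂ) :
      twoPoint S (S *ᵥ f) g = twoPoint 1 v g - twoPoint S v g := by
    have e1 : twoPoint S (S *ᵥ f) g = twoPoint ((1 - S) * S) f g := by
      have := hsymm f (S *ᵥ g)
      rwa [twoPoint_mulVec, twoPoint_mulVec, one_mul] at this
    have e2 : twoPoint 1 v g - twoPoint S v g = twoPoint 1 v ((1 - S) *ᵥ g) := by
      rw [twoPoint_mulVec, one_mul, twoPoint_sub]
    rw [e1, e2, hv, twoPoint_sub_left, hsymm, twoPoint_mulVec, twoPoint_mulVec, ← twoPoint_sub]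
    congr 1
    noncomm_ring
  refine eq_of_correlations fun k g => ?_
  match k, g with
  | 0, g =>
    rw [List.ofFn_zero, List.prod_nil, mul_one, mul_one, Matrix.trace_mul_comm (field v),
      h.trace_field, h.trace_field]
  | m + 1, g =>
    set Q := (List.ofFn fun i => field (g i)).prod with hQ
    have hL := h.trace_field_mul_prod (S *ᵥ f) g
    have hv' := h.trace_field_mul_prod v g
    have hmove := congrArg (fun M => (ρ * M).trace) (mul_prod_ofFn_of_anticomm (field v)
      (fun i => field (g i)) (fun i => twoPoint 1 v (g i)) fun j => field_anticomm _ _)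
    simp only [mul_add, Finset.mul_sum, Matrix.mul_smul, Matrix.trace_add, Matrix.trace_sum,
      Matrix.trace_smul, smul_eq_mul] at hmove
    rw [← hQ] at hL hv' hmove
    rw [mul_assoc, hL, mul_assoc, Matrix.trace_mul_comm (field v), mul_assoc]
    rw [hv'] at hmove
    rcases Nat.even_or_odd m with hm | hm
    · rw [hm.add_one.neg_one_pow] at hmove
      have : (ρ * (Q * field v)).trace = ∑ j : Fin (m + 1), (-1) ^ (j : ℕ) * twoPoint 1 v (g j) *
          (ρ * (List.ofFn fun i => field (g (j.succAbove i))).prod).trace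
          - ∑ j : Fin (m + 1), (-1) ^ (j : ℕ) * twoPoint S v (g j) *
          (ρ * (List.ofFn fun i => field (g (j.succAbove i))).prod).trace := by
        linear_combination hmove
      rw [this, ← Finset.sum_sub_distrib]
      refine Finset.sum_congr rfl fun j _ => ?_
      rw [hkey]; ring
    · -- correlations of odd order vanish
      have h0 (j : Fin (m + 1)) :
          (ρ * (List.ofFn fun i => field (g (j.succAbove i))).prod).trace = 0 := by
        rw [h.wick m fun i => g (j.succAbove i), wickSum_odd _ _ _ hm]
      simp only [h0, mul_zero, Finset.sum_const_zero, zero_add, hm.add_one.neg_one_pow,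
        one_mul] at hmove ⊢
      exact hmove

/-- The covariance of a pure quasifree state is a projection. -/
lemma mul_self_of_isPure (h : IsQuasifreeWith S ρ) (hp : IsPure ρ) : S * S = S := by
  have hρρ : ρ * ρ = ρ := by
    have := hp.mul_mul_self 1
    rwa [mul_one, h.isDensity.2, one_smul] at this
  have h0 (f : GlobalIdx n → ℂ) : ρ * field (S *ᵥ f) = 0 := by
    rw [← hρρ, mul_assoc, h.mul_field, ← mul_assoc, hp.mul_mul_self, h.trace_field, zero_smul]
  have h1 (f g : GlobalIdx n → ℂ) : twoPoint S g (S *ᵥ f) = twoPoint S g f := by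
    have e1 : twoPoint S (S *ᵥ f) g = 0 := by
      rw [← h.covariance, ← mul_assoc, h0, zero_mul, Matrix.trace_zero]
    have e2 := h.twoPoint_add_twoPoint g (S *ᵥ f)
    rwa [e1, add_zero, twoPoint_mulVec 1, one_mul] at e2
  ext i k
  have := h1 (Pi.single k 1) (Pi.single (swapIdx i) 1)
  rwa [twoPoint_mulVec, twoPoint_single, twoPoint_single, swapIdx_swapIdx] at this

end IsQuasifreeWith

/-! ### Reductions of maximally entangled quasifree states -/

lemma isCAR_annihilation : IsCAR fun j : Fin n => annihilation j :=
  ⟨annihilation_anticomm, fun j k => by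
    rw [conjTranspose_annihilation]; exact annihilation_creation_anticomm j k⟩

/-- For two or more modes, some Majorana operator commutes with the product of any two given ones
but anticommutes with the parity. -/
lemma trace_parityOp_mul_majorana (hn : 2 ≤ n) (k l : Fin n ⊕ Fin n) :
    (parityOp n * (majorana (annihilation (n := n)) k * majorana annihilation l)).trace = 0 := by
  obtain ⟨m, hm⟩ : ∃ m, m ∉ ({k, l} : Finset (Fin n ⊕ Fin n)) := by
    by_contra! hall
    have h1 : (Finset.univ : Finset (Fin n ⊕ Fin n)) ⊆ {k, l} := fun m _ => hall m
    have h2 := (Finset.card_le_card h1).trans Finset.card_le_two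
    simp at h2
    omega
  have hmk : k ≠ m := fun e => hm (by simp [e])
  have hml : l ≠ m := fun e => hm (by simp [e])
  set γ := majorana (annihilation (n := n)) with hγ
  have hc : IsCAR (annihilation (n := n)) := isCAR_annihilation
  have hθ : parityOp n * γ m = -(γ m * parityOp n) :=
    mul_majorana conjTranspose_parityOp parityOp_mul_annihilation m
  have e1 : γ k * γ l * γ m = γ m * (γ k * γ l) := by
    rw [mul_assoc, hc.majorana_mul_comm hml, mul_neg, ← mul_assoc, hc.majorana_mul_comm hmk,
      neg_mul, neg_neg, mul_assoc]
  have hmm : γ m * γ m = 1 := hc.majorana_mul_self m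
  have e2 : parityOp n * (γ k * γ l) = -(γ m * (parityOp n * (γ k * γ l)) * γ m) := by
    calc parityOp n * (γ k * γ l) = γ m * γ m * (parityOp n * (γ k * γ l)) := by rw [hmm, one_mul]
      _ = -(γ m * -(γ m * parityOp n) * (γ k * γ l)) := by noncomm_ring
      _ = -(γ m * parityOp n * (γ m * (γ k * γ l))) := by rw [← hθ]; noncomm_ring
      _ = -(γ m * (parityOp n * (γ k * γ l)) * γ m) := by rw [← e1]; noncomm_ring
  have e3 := congrArg Matrix.trace e2
  rw [Matrix.trace_neg, Matrix.trace_mul_comm (γ m * _) (γ m), ← mul_assoc (γ m) (γ m), hmm, one_mul] at e3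
  linear_combination (1 / 2 : ℂ) * e3

lemma trace_parityOp (hn : 2 ≤ n) : (parityOp n).trace = 0 := by
  have := trace_parityOp_mul_majorana hn (Sum.inl ⟨0, by omega⟩) (Sum.inl ⟨0, by omega⟩)
  rwa [isCAR_annihilation.majorana_mul_self, mul_one] at this

lemma trace_parityOp_mul_ladder (hn : 2 ≤ n) (i k : LocalIdx n) :
    (parityOp n * (ladder i * ladder k)).trace = 0 := by
  have hl (i : LocalIdx n) : ∃ a b : ℂ, ∃ p q,
      ladder i = a • majorana (annihilation (n := n)) p + b • majorana annihilation q := by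
    rcases i with j | j
    · refine ⟨1 / 2, -(1 / 2 * Complex.I), Sum.inl j, Sum.inr j, ?_⟩
      refine (eq_majorana (a := annihilation (n := n)) j).trans ?_
      rw [smul_sub, smul_smul, neg_smul, sub_eq_add_neg]
    · refine ⟨1 / 2, 1 / 2 * Complex.I, Sum.inl j, Sum.inr j, ?_⟩
      refine (conjTranspose_annihilation j).symm.trans
        ((conjTranspose_eq_majorana (a := annihilation (n := n)) j).trans ?_)
      rw [smul_add, smul_smul]
  obtain ⟨a, b, p, q, h1⟩ := hl i
  obtain ⟨c, d, r, s, h2⟩ := hl k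
  rw [h1, h2]
  simp only [mul_add, add_mul, Matrix.smul_mul, Matrix.mul_smul, Matrix.trace_add,
    Matrix.trace_smul, trace_parityOp_mul_majorana hn, smul_zero, add_zero]

lemma trace_ladder_mul_ladder (i k : LocalIdx n) :
    (ladder i * ladder k).trace = if i = k.swap then (1 / 2 : ℂ) * (1 : FockOp n).trace else 0 := by
  have h := congrArg Matrix.trace (ladder_anticomm i k)
  rw [Matrix.trace_add, Matrix.trace_mul_comm (ladder k)] at h
  split_ifs at h ⊢ with hik
  · linear_combination (1 / 2 : ℂ) * h
  · rw [Matrix.trace_zero] at h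
    linear_combination (1 / 2 : ℂ) * h

/-- Alice's reduction of an even maximally entangled state depends on the parity only. -/
lemma IsMaxEntangled.traceRight_eq {ρ : PairOp n} (h : IsMaxEntangled ρ)
    (hΘ : totalParity n * ρ * totalParity n = ρ) :
    ∃ α β : ℂ, traceRight ρ = α • 1 + β • parityOp n := by
  -- blocks of vanishing weight are zero, so the reductions of all blocks are scalar
  have hblock (a b : ZMod 2) : ∃ t : ℂ, traceRight (parityBlock ρ a b) = t • 1 := by
    by_cases ht : (parityBlock ρ a b).trace = 0
    · have h0 : parityBlock ρ a b = 0 :=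
        ((h.1.isDensity.1.submatrix _).trace_eq_zero_iff).1 ht
      refine ⟨0, ?_⟩
      rw [h0]; ext; simp [traceRight]
    · have h1 := (h.2 a b ht).2.1
      refine ⟨(parityBlock ρ a b).trace * (Fintype.card (Sector n a) : ℂ)⁻¹, ?_⟩
      rw [mul_smul, ← h1]
      ext x x'
      simp only [traceRight, Matrix.smul_apply, Matrix.of_apply, ← Finset.smul_sum]
      rw [smul_inv_smul₀ ht]
  choose t ht using hblock
  have hsame (x x' : FockIdx n) (hxx : (x.card : ZMod 2) = x'.card) :
      traceRight ρ x x' = if x = x' then t x.card 0 + t x.card 1 else 0 := by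
    have hb (b : ZMod 2) : ∑ y : Sector n b, ρ (x, y.1) (x', y.1)
        = if x = x' then t x.card b else 0 := by
      have := congrFun (congrFun (ht x.card b) ⟨x, rfl⟩) ⟨x', hxx.symm⟩
      rw [Matrix.smul_apply, Matrix.one_apply] at this
      exact this.trans (by simp)
    have hsplit : traceRight ρ x x'
        = ∑ y : Sector n 0, ρ (x, y.1) (x', y.1) + ∑ y : Sector n 1, ρ (x, y.1) (x', y.1) := by
      have h2 : ∀ z : ZMod 2, z ≠ 0 ↔ z = 1 := by decide
      simp only [traceRight, Matrix.of_apply]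
      rw [← Finset.sum_filter_add_sum_filter_not Finset.univ
          (fun y : FockIdx n => (y.card : ZMod 2) = 0),
        Finset.sum_subtype (p := fun y : FockIdx n => (y.card : ZMod 2) = 0) _ (by simp),
        Finset.sum_subtype (p := fun y : FockIdx n => (y.card : ZMod 2) = 1) _
          (fun y => by simpa using h2 _)]
    rw [hsplit, hb, hb]
    split_ifs <;> simp
  have hdiff (x x' : FockIdx n) (hxx : (x.card : ZMod 2) ≠ x'.card) : traceRight ρ x x' = 0 := by
    change ∑ y, ρ (x, y) (x', y) = 0
    refine Finset.sum_eq_zero fun y _ => ?_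
    by_contra hne
    exact hxx (add_right_cancel (parity_eq_of_apply_ne_zero hΘ hne))
  set r : ZMod 2 → ℂ := fun a => t a 0 + t a 1 with hr
  refine ⟨(r 0 + r 1) / 2, (r 0 - r 1) / 2, ?_⟩
  ext x x'
  rw [Matrix.add_apply, Matrix.smul_apply, Matrix.smul_apply, parityOp, Matrix.one_apply,
    Matrix.diagonal_apply]
  by_cases hxx : x = x'
  · subst hxx
    rw [hsame x x rfl, if_pos rfl, if_pos rfl, if_pos rfl]
    rcases Nat.even_or_odd x.card with he | ho
    · have : (x.card : ZMod 2) = 0 := (ZMod.natCast_eq_zero_iff_even).2 he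
      rw [this, he.neg_one_pow]; simp only [hr, smul_eq_mul]; ring
    · have : (x.card : ZMod 2) = 1 := (ZMod.natCast_eq_one_iff_odd).2 ho
      rw [this, ho.neg_one_pow]; simp only [hr, smul_eq_mul]; ring
  · rw [if_neg hxx, if_neg hxx, smul_zero, smul_zero, add_zero]
    by_cases hc : (x.card : ZMod 2) = x'.card
    · rw [hsame x x' hc, if_neg hxx]
    · exact hdiff x x' hc

/-- Alice's covariance in a maximally entangled quasifree state is the totally mixed one. For a
single mode this fails, as the parity is then quadratic in the fields. -/
lemma IsQuasifreeWith.toBlocks₁₁_eq (hn : 2 ≤ n) {S : Matrix (GlobalIdx n) (GlobalIdx n) ℂ}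
    {ρ : PairOp n} (h : IsQuasifreeWith S ρ) (hm : IsMaxEntangled ρ) :
    S.toBlocks₁₁ = (1 / 2 : ℂ) • 1 := by
  obtain ⟨α, β, hR⟩ := hm.traceRight_eq h.totalParity_conj
  have hα : α * (1 : FockOp n).trace = 1 := by
    have := h.isDensity.2
    rw [← trace_traceRight, hR, Matrix.trace_add, Matrix.trace_smul, Matrix.trace_smul,
      trace_parityOp hn, smul_zero, add_zero] at this
    exact this
  ext i k
  have e : S (Sum.inl i) (Sum.inl k) = (traceRight ρ * (ladder i.swap * ladder k)).trace := by
    rw [← trace_mul_kronecker_one, h.apply_eq]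
    change (ρ * (field (Pi.single (Sum.inl i.swap) 1) * _)).trace = _
    rw [field_inl_single, field_inl_single, ← Matrix.mul_kronecker_mul, one_mul]
  change S (Sum.inl i) (Sum.inl k) = _
  rw [e, hR, add_mul, Matrix.smul_mul, Matrix.smul_mul, one_mul, Matrix.trace_add,
    Matrix.trace_smul, Matrix.trace_smul, trace_parityOp_mul_ladder hn, smul_zero, add_zero,
    trace_ladder_mul_ladder, Matrix.smul_apply, Matrix.one_apply]
  by_cases hik : i = k
  · subst hik
    simp only [if_true, smul_eq_mul]
    linear_combination (1 / 2 : ℂ) * hα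
  · have : ¬ i.swap = k.swap := fun hh => hik (by
      rw [← Sum.swap_swap i, hh, Sum.swap_swap])
    rw [if_neg hik, if_neg this, smul_zero, smul_zero]

/-- The covariances of maximally entangled quasifree states form one orbit of the Bogolubov
transformations of Bob. -/
lemma IsQuasifreeWith.exists_covariance_eq (hn : 2 ≤ n)
    {S : Matrix (GlobalIdx n) (GlobalIdx n) ℂ} {ρ : PairOp n} (h : IsQuasifreeWith S ρ)
    (hm : IsMaxEntangled ρ) :
    ∃ VB : Matrix (LocalIdx n) (LocalIdx n) ℂ, IsLocalBogolubov VB ∧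
      S = blockDiag 1 VB * standardCov n * (blockDiag 1 VB)ᴴ := by
  have hSS := h.mul_self_of_isPure hm.1
  set X := S.toBlocks₁₂ with hX
  set Y := S.toBlocks₂₁ with hY
  set D := S.toBlocks₂₂ with hD
  have hS : S = Matrix.fromBlocks ((1 / 2 : ℂ) • 1) X Y D := by
    rw [← h.toBlocks₁₁_eq hn hm, hX, hY, hD, Matrix.fromBlocks_toBlocks]
  have hYX : Yᴴ = X := by
    ext i k; exact h.star_apply (Sum.inr k) (Sum.inl i)
  rw [hS, Matrix.fromBlocks_multiply, Matrix.fromBlocks_inj] at hSS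
  obtain ⟨h11, h12, -, -⟩ := hSS
  have hXY : X * ((4 : ℂ) • Y) = 1 := by
    have : X * Y = (1 / 2 : ℂ) • 1 - ((1 / 2 : ℂ) • 1) * ((1 / 2 : ℂ) • 1) :=
      eq_sub_of_add_eq' h11
    rw [Matrix.mul_smul, this, Matrix.smul_mul, one_mul]
    module
  have hYX4 : ((4 : ℂ) • Y) * X = 1 := mul_eq_one_comm.1 hXY
  have hD2 : D = (1 / 2 : ℂ) • 1 := by
    have h1 : X * D = (1 / 2 : ℂ) • X := by
      have : X * D = X - ((1 / 2 : ℂ) • 1) * X := eq_sub_of_add_eq' h12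
      rw [this, Matrix.smul_mul, one_mul]
      module
    have h2 : ((4 : ℂ) • Y) * (X * D) = D := by rw [← mul_assoc, hYX4, one_mul]
    rw [← h2, h1, Matrix.mul_smul, hYX4]
  have hVs : ((2 * Complex.I) • Y)ᴴ = (-(2 * Complex.I)) • X := by
    rw [Matrix.conjTranspose_smul, hYX]; simp
  have h4 : (2 * Complex.I) * -(2 * Complex.I) = 4 := by linear_combination (-4) * Complex.I_mul_I
  have hVV : ((2 * Complex.I) • Y) * ((2 * Complex.I) • Y)ᴴ = 1 := by
    rw [hVs, Matrix.smul_mul, Matrix.mul_smul, smul_smul, h4, ← Matrix.smul_mul, hYX4]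
  refine ⟨(2 * Complex.I) • Y, ⟨Matrix.mem_unitaryGroup_iff.2 hVV, fun f => ?_⟩, ?_⟩
  · -- `V_B` commutes with `Γ_B`, by selfadjointness of `S` and `S + Γ S Γ = 1`
    have hconj (i k : LocalIdx n) : star (Y i.swap k) = -Y i k.swap := by
      have e1 : star (Y i.swap k) = X k i.swap := h.star_apply (Sum.inr i.swap) (Sum.inl k)
      have e2 := h.apply_add_apply (Sum.inl k) (Sum.inr i.swap)
      change X k i.swap + Y i.swap.swap k.swap = _ at e2
      rw [Sum.swap_swap, Matrix.one_apply_ne (by simp)] at e2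
      rw [e1]; linear_combination e2
    ext i
    simp only [localConj, Matrix.mulVec, dotProduct, star_sum, star_mul', Matrix.smul_apply,
      smul_eq_mul, hconj]
    refine Fintype.sum_equiv (Equiv.sumComm _ _) _ _ fun k => ?_
    simp
  · rw [hS, hD2, blockDiag, standardCov, Matrix.mul_smul, Matrix.smul_mul,
      Matrix.fromBlocks_conjTranspose, Matrix.fromBlocks_multiply, Matrix.fromBlocks_multiply,
      Matrix.fromBlocks_smul]
    have hI (Z : Matrix (LocalIdx n) (LocalIdx n) ℂ) :
        Z = (1 / 2 : ℂ) • Complex.I • -(2 * Complex.I) • Z := by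
      rw [smul_smul, smul_smul]
      have : (1 / 2 : ℂ) * Complex.I * -(2 * Complex.I) = 1 := by
        linear_combination -Complex.I_mul_I
      rw [this, one_smul]
    simp only [Matrix.conjTranspose_one, Matrix.conjTranspose_zero, mul_one, one_mul, mul_zero,
      smul_zero, neg_zero, zero_add, add_zero, hVV, Matrix.smul_mul _ (1 : Matrix (LocalIdx n) _ ℂ),
      mul_neg, Matrix.mul_smul _ _ (1 : Matrix (LocalIdx n) _ ℂ)]
    congr 1
    · rw [hVs]; exact hI X
    · simpa only [neg_smul, smul_neg] using hI Y

end FermionPair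

end

theorem theorem2 (n : ℕ) (hn : 2 ≤ n) :
    ∃ ρst : PairOp n,
      -- the standard state exists, is determined by its covariance, and is maximally entangled
      (IsQuasifreeWith (standardCov n) ρst ∧ IsMaxEntangled ρst ∧
        ∀ ρ : PairOp n, IsQuasifreeWith (standardCov n) ρ → ρ = ρst) ∧
      -- local Bogolubov transformations take it to maximally entangled quasifree states
      (∀ VA VB : Matrix (LocalIdx n) (LocalIdx n) ℂ, IsLocalBogolubov VA → IsLocalBogolubov VB →
        ∃ ρ : PairOp n, IsBogolubovImage (blockDiag VA VB) ρst ρ ∧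
          IsQuasifreeWith (blockDiag VA VB * standardCov n * (blockDiag VA VB)ᴴ) ρ ∧
          IsMaxEntangled ρ) ∧
      -- every maximally entangled quasifree state arises in this way
      (∀ ρ : PairOp n, IsQuasifree ρ → IsMaxEntangled ρ →
        ∃ VA VB : Matrix (LocalIdx n) (LocalIdx n) ℂ, IsLocalBogolubov VA ∧ IsLocalBogolubov VB ∧
          IsBogolubovImage (blockDiag VA VB) ρst ρ ∧
          IsQuasifreeWith (blockDiag VA VB * standardCov n * (blockDiag VA VB)ᴴ) ρ) := by
  obtain ⟨ρst, hq, hp, hR⟩ := exists_standardState n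
  have horbit (VA VB : Matrix (LocalIdx n) (LocalIdx n) ℂ) (hA : IsLocalBogolubov VA)
      (hB : IsLocalBogolubov VB) : ∃ ρ : PairOp n, IsBogolubovImage (blockDiag VA VB) ρst ρ ∧
        IsQuasifreeWith (blockDiag VA VB * standardCov n * (blockDiag VA VB)ᴴ) ρ ∧
        IsMaxEntangled ρ := by
    have hV := hA.blockDiag hB
    obtain ⟨U, hU, hUV⟩ := hV.exists_implementer
    have hq' := hq.conj hV hU hUV
    refine ⟨Uᴴ * ρst * U, ⟨U, hU, hUV, rfl⟩, hq', isMaxEntangled_of_traceRight ?_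
      hq'.totalParity_conj (traceRight_conj hV hU hUV hR)⟩
    exact hp.conj hU
  refine ⟨ρst, ⟨hq, isMaxEntangled_of_traceRight hp hq.totalParity_conj hR,
    fun ρ hρ => hρ.unique hq⟩, horbit, ?_⟩
  rintro ρ ⟨S, hS⟩ hm
  obtain ⟨VB, hB, hSV⟩ := hS.exists_covariance_eq hn hm
  have hA : IsLocalBogolubov (1 : Matrix (LocalIdx n) (LocalIdx n) ℂ) :=
    ⟨one_mem _, fun f => by simp⟩
  obtain ⟨ρ', himg, hq', -⟩ := horbit 1 VB hA hB
  rw [hSV] at hS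
  obtain rfl := hS.unique hq'
  exact ⟨1, VB, hA, hB, himg, hq'⟩
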